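/- Setting. Let $n\ge 2$ and $p_c=\frac{2(n+1)}{n-1}$. Let $L^*\subset\mathbb R^n$ be the lattice spanned by a basis of $\mathbb R^n$, $\mathbb T^n=\mathbb R^n/L^*$ with Lebesgue measure, $L$ the dual lattice (all $k$ with $\langle k,\ell\rangle\in\mathbb Z$ for every $\ell\in L^*$), $e_k(x)=|\mathbb T^n|^{-1/2}e^{2\pi i\langle k,x\rangle}$ and $\hat f(k)=\int_{\mathbb T^n}f(x)e_k(-x)\,dx$ for $k\in L$. For a function $m$ of bounded support on $\mathbb R^n$ let $T_mf=\sum_{k\in L}m(2\pi k)\hat f(k)e_k$. Let $A_{\lambda,w}=\{\xi\in\mathbb R^n:\ \big||\xi|-\lambda\big|<w\}$. *Caps.* Fix $K\ge1$. A cap is a closed box $\omega\subset\mathbb R^n$ with dimensions $c_1(\lambda\delta)^{1/2}\times\dots\times c_{n-1}(\lambda\delta)^{1/2}\times c_n\delta$, $c_i\in[K^{-1},K]$, of any centre and orientation for which $\omega\subset A_{\lambda,K\delta}$. A cap partition is a finite family $\Omega$ of caps covering $A_{\lambda,\delta}$, no point lying in more than $K$ of them, together with smooth functions $0\le\chi_\omega\le1$,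 $\operatorname{supp}\chi_\omega\subset\omega$, with $\sum_{\omega\in\Omega}\chi_\omega=1$ on $A_{\lambda,\delta}$. Let $\#\omega$ be the number of points of $\omega\cap2\pi L$, and let $d_\omega$ be the dimension of the real span of the differences of these points. For fixed $c,\eta>0$, the cap $\omega$ is bad if $\#\omega\ge c(\lambda\delta)^{\frac{n-1}2-\eta}$. *Sectors.* For a set $\Gamma$ of unit vectors at distance at most $\frac12$ from $(0,\dots,0,1)$, let $\gamma=\{\xi\in A_{\lambda,\delta}:\ \xi/|\xi|\in\Gamma\}$, $P_\gamma=T_{1_\gamma}$ and $P^\gamma_{\mathrm{bad}}=T_m$ with $m=1_\gamma\sum_{\omega\in\Omega\ \mathrm{bad}}\chi_\omega$. **Proposition.** For every $n\ge2$ there are $\eta_0>0$ and $\sigma_2>0$, depending only on $n$, such that for every $L^*$ as above and all $\kappa,\tau,c,s>0$, $K\ge1$ and $0<\eta\le\eta_0$ with $\eta<\tau$ there is a constant $C>0$, depending only on $n,L^*,\eta,\kappa,\tau,K,c,s$, with the following property. Let $\lambda\ge1$ and $\lambda^{-1+\kappa}\le\delta\le1$, let $(\Omega,\chi)$ be a cap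 partition, and suppose that every bad cap $\omega\in\Omega$ has $d_\omega=n-1$, or that $\delta\le\lambda^{-\tau}$. Let $\Gamma,\Gamma'$ be sets of unit vectors at distance at most $\frac12$ from $(0,\dots,0,1)$ such that $|u-u'|\ge s\delta$ for all $u\in\Gamma$, $u'\in\Gamma'$, and let $\gamma,\gamma'$ be the corresponding sectors. Then for every $f\in L^2(\mathbb T^n)$ $$\big\|(P^{\gamma}_{\mathrm{bad}}f\;P^{\gamma'}_{\mathrm{bad}}f)^{1/2}\big\|_{L^{p_c}(\mathbb T^n)}\le C(\lambda\delta)^{\frac1{p_c}-\sigma_2}\big(\|P_\gamma f\|_{L^2(\mathbb T^n)}\|P_{\gamma'}f\|_{L^2(\mathbb T^n)}\big)^{1/2}.$$ -/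

import Mathlib

open MeasureTheory
open scoped InnerProductSpace

noncomputable section

/-- `ℝⁿ` with the Euclidean norm. -/
abbrev Euc (n : ℕ) : Type := EuclideanSpace ℝ (Fin n)

/-! ### The torus `ℝⁿ / L*`, its dual lattice and its Fourier multipliers -/

/-- Lebesgue measure on the torus `ℝⁿ / L*`, where `L*` is the lattice spanned over `ℤ` by the
basis `b`. The torus is identified with the half-open fundamental parallelepiped of `b`. -/
def torusMeasure {n : ℕ} (b : Module.Basis (Fin n) ℝ (Euc n)) : Measure (Euc n) :=
  volume.restrict (ZSpan.fundamentalDomain b)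

/-- The lattice `L` dual to `L*`: all `k` with `⟨k, ℓ⟩ ∈ ℤ` for every `ℓ ∈ L*`
(it is enough to ask this for the generators of `L*`). -/
def dualLattice {n : ℕ} (b : Module.Basis (Fin n) ℝ (Euc n)) : Set (Euc n) :=
  {k | ∀ i, ∃ m : ℤ, ⟪k, b i⟫_ℝ = m}

/-- The exponential `e_k(x) = c e^{2πi⟨k, x⟩}`, with the constant `c = vol(𝕋ⁿ)^{-1/2}` that gives
it norm one in `L²(𝕋ⁿ)`. -/
def torusExp {n : ℕ} (b : Module.Basis (Fin n) ℝ (Euc n)) (k x : Euc n) : ℂ :=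
  (((torusMeasure b).real Set.univ ^ (-(1 / 2) : ℝ) : ℝ) : ℂ) *
    Complex.exp (2 * Real.pi * Complex.I * ((⟪k, x⟫_ℝ : ℝ) : ℂ))

/-- The Fourier coefficient `f̂(k) = ∫ f(x) e_k(-x) dx`. -/
def torusCoeff {n : ℕ} (b : Module.Basis (Fin n) ℝ (Euc n)) (f : Euc n → ℂ) (k : Euc n) : ℂ :=
  ∫ x, f x * torusExp b k (-x) ∂(torusMeasure b)

/-- The Fourier multiplier with symbol `m`: `f ↦ ∑_{k ∈ L} m(2πk) f̂(k) e_k`. It is only used for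
symbols of bounded support, for which the sum has finitely many nonzero terms. -/
def torusMultiplier {n : ℕ} (b : Module.Basis (Fin n) ℝ (Euc n)) (m : Euc n → ℝ)
    (f : Euc n → ℂ) (x : Euc n) : ℂ :=
  ∑' k : dualLattice b,
    ((m ((2 * Real.pi) • (k : Euc n)) : ℝ) : ℂ) * torusCoeff b f k * torusExp b k x

/-- The lattice `2πL` of frequencies. -/
def frequencyLattice {n : ℕ} (b : Module.Basis (Fin n) ℝ (Euc n)) : Set (Euc n) :=
  (fun k => (2 * Real.pi) • k) '' dualLattice b

/-! ### Annuli and angular sectors -/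

/-- The annulus `{ξ : |ξ| ∈ (lam - w, lam + w)}`. -/
def annulus (n : ℕ) (lam w : ℝ) : Set (Euc n) := {ξ | |‖ξ‖ - lam| < w}

/-- The part of the annulus of radius `lam` and half-width `δ` with directions in `Γ`. -/
def sector {n : ℕ} (lam δ : ℝ) (Γ : Set (Euc n)) : Set (Euc n) :=
  {ξ | ξ ∈ annulus n lam δ ∧ ‖ξ‖⁻¹ • ξ ∈ Γ}

/-- The unit vector `(0, …, 0, 1)`. -/
def northPole (n : ℕ) : Euc n := WithLp.toLp 2 fun i : Fin n => if (i : ℕ) + 1 = n then 1 else 0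

/-- The fixed neighbourhood of `(0, …, 0, 1)` in the unit sphere. -/
def polarDirections (n : ℕ) : Set (Euc n) := {u | ‖u‖ = 1 ∧ ‖u - northPole n‖ ≤ 1 / 2}

/-- The projection `P_γ`, where `γ` is the sector of the annulus with directions in `Γ`. -/
def sectorProj {n : ℕ} (b : Module.Basis (Fin n) ℝ (Euc n)) (lam δ : ℝ) (Γ : Set (Euc n))
    (f : Euc n → ℂ) : Euc n → ℂ :=
  torusMultiplier b ((sector lam δ Γ).indicator fun _ => 1) f

/-! ### Caps -/

/-- A closed box in `ℝⁿ` with arbitrary centre, orientation and side lengths. -/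
structure Box (n : ℕ) where
  center : Euc n
  axis : OrthonormalBasis (Fin n) ℝ (Euc n)
  side : Fin n → ℝ

/-- The box as a set of points. -/
def Box.points {n : ℕ} (Q : Box n) : Set (Euc n) :=
  {ξ | ∀ i, |⟪Q.axis i, ξ - Q.center⟫_ℝ| ≤ Q.side i / 2}

/-- A cap of the annulus of radius `lam` and half-width `δ`: a box of dimensions
`c₁(lam δ)^{1/2} × … × c_{n-1}(lam δ)^{1/2} × cₙ δ` with constants `cᵢ ∈ [K⁻¹, K]`, which stays
within distance `K δ` of the sphere of radius `lam`. -/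
structure Box.IsCap {n : ℕ} (Q : Box n) (K lam δ : ℝ) : Prop where
  long_side : ∀ i : Fin n, (i : ℕ) + 1 < n →
    K⁻¹ * (lam * δ) ^ (1 / 2 : ℝ) ≤ Q.side i ∧ Q.side i ≤ K * (lam * δ) ^ (1 / 2 : ℝ)
  short_side : ∀ i : Fin n, (i : ℕ) + 1 = n → K⁻¹ * δ ≤ Q.side i ∧ Q.side i ≤ K * δ
  near_sphere : Q.points ⊆ annulus n lam (K * δ)

/-- The number `#Q` of lattice points (of `2πL`) in a box. -/
def Box.count {n : ℕ} (b : Module.Basis (Fin n) ℝ (Euc n)) (Q : Box n) : ℕ :=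
  (Q.points ∩ frequencyLattice b).ncard

/-- The dimension `d_Q` of the real span of the lattice points in a box, after the box has been
shifted so that one of them is at the origin. -/
def Box.latticeDim {n : ℕ} (b : Module.Basis (Fin n) ℝ (Euc n)) (Q : Box n) : ℕ :=
  Module.finrank ℝ (vectorSpan ℝ (Q.points ∩ frequencyLattice b))

/-- A box is bad if it contains at least `c (lam δ)^{(n-1)/2 - η}` lattice points. -/
def Box.IsBad {n : ℕ} (b : Module.Basis (Fin n) ℝ (Euc n)) (c η lam δ : ℝ) (Q : Box n) : Prop :=
  c * (lam * δ) ^ (((n : ℝ) - 1) / 2 - η) ≤ (Q.count b : ℝ)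

/-- A finite family `Ω` of caps with overlap at most `K` covering the annulus, together with a
smooth partition of unity `(χ_Q)` of the annulus subordinate to it. -/
structure IsCapPartition {n : ℕ} {ι : Type} [Fintype ι] (K lam δ : ℝ)
    (Ω : ι → Box n) (χ : ι → Euc n → ℝ) : Prop where
  isCap : ∀ i, (Ω i).IsCap K lam δ
  overlap : ∀ ξ, ({i | ξ ∈ (Ω i).points}.ncard : ℝ) ≤ K
  cover : annulus n lam δ ⊆ ⋃ i, (Ω i).points
  smooth : ∀ i, ContDiff ℝ (⊤ : ℕ∞) (χ i)
  nonneg : ∀ i ξ, 0 ≤ χ i ξ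
  le_one : ∀ i ξ, χ i ξ ≤ 1
  support : ∀ i, tsupport (χ i) ⊆ (Ω i).points
  sum_eq_one : ∀ ξ ∈ annulus n lam δ, ∑ i, χ i ξ = 1

open Classical in
/-- The projection `P^γ_bad = P_γ P_bad` with `P_bad = ∑_{Q bad} P_Q`, that is, the multiplier with
symbol `∑_{Q bad} χ_Q` restricted to the sector `γ` of the annulus. -/
def badSectorProj {n : ℕ} {ι : Type} [Fintype ι] (b : Module.Basis (Fin n) ℝ (Euc n))
    (c η lam δ : ℝ) (Ω : ι → Box n) (χ : ι → Euc n → ℝ) (Γ : Set (Euc n))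
    (f : Euc n → ℂ) : Euc n → ℂ :=
  torusMultiplier b
    ((sector lam δ Γ).indicator fun ξ =>
      ∑ i, if (Ω i).IsBad b c η lam δ then χ i ξ else 0) f

/-- The critical exponent `p_c = 2(n+1)/(n-1)`. -/
def critExp (n : ℕ) : ℝ := 2 * ((n : ℝ) + 1) / ((n : ℝ) - 1)

end

/-!
Write `R = (lam δ)^{1/2}` and `q = R^{2η}`. A bad cap has diameter `O(R)` and at least `c R^{n-1} / q`
lattice points. The proof rests on the fact that there are very few bad caps, only `q^{O(1)}` of
them, so that no decoupling inequality is needed to superpose them.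

For large `lam` the lattice points of a bad cap span a hyperplane, with direction `V` say. In lower
dimension there is no room for that many points. In full dimension their number would be at most
proportional to the volume of the cap (`ncard_le_volume_of_vectorSpan_eq_top`), which is too small
when `δ ≤ lam^{-τ}` and `η < τ`. As the cap is close to a sphere, its chords are orthogonal to its
points up to `O(R²)`. If a point of the cap had a component larger than `O(R q)` in `V`, the lattice
points would lie in a slab of `V` which is too thin to hold them. Hence the cap lies in a tube of
width `O(R q)` around the normal line of `V`. By pigeonholing, `V` is also spanned by lattice vectors
of length `O(q)` (`exists_short_span`). These facts are collected in `exists_badCap_structure`. They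
leave `q^{O(1)}` possible spaces `V`, and each of them belongs to `q^{O(1)}` bad caps, as the tube
meets the annulus in few lattice points and the caps overlap boundedly (`exists_card_badCaps_le`).

If two bad caps meet the two separated sectors, their tubes point in different directions
(`not_both_mem_tube`), and therefore `V ≠ V'`. A frequency `m` then has at most `O(R^{n-2})`
representations as a sum of a lattice point of each cap, because the first summand ranges over a
coset of `V ⊓ V'`. Hence the frequencies of `F = P^γ_bad f` and `G = P^γ'_bad f` are
`Y = O(R^{n-1} q^{O(1)})` in number, and a frequency has at most `X = O(R^{n-2} q^{O(1)})`
representations as a sum of a frequency of `F` and one of `G` (`exists_ncard_badFrequencies_le`).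

Put `A = ‖F‖₂ ‖G‖₂`, which is at most `‖P_γ f‖₂ ‖P_γ' f‖₂` as the cutoffs sum to at most `1`. By the
Cauchy–Schwarz inequality and Parseval's identity `‖F G‖₁ ≤ A`, `‖F G‖₂² = O(X A²)` and
`‖F G‖_∞ = O(Y A)`, so that `‖F G‖₃³ = O(X Y A³)`. As `1 < p_c / 2 ≤ 3`,
interpolation (`lintegral_enorm_mul_rpow_le`) bounds the integral of `|F G|^{p_c/2}` by
`O((X Y)^{1/(n-1)} A^{p_c/2})`. The exponent of `R` in `X Y` is `2n - 3 + O(η)` instead of the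
critical `2n - 2`, and this is the gain.
-/

/-! ### Counting separated points -/

/-- A set `P` with width at most `w i` in each direction `e i` splits into cells of diameter less
than `ρ`, labelled by integer vectors in a finite set `J` of controlled size. The first hypothesis
on the differences of points of `P` holds when they lie in the span of an orthonormal family `e`. -/
theorem exists_cell_map {E : Type*} [NormedAddCommGroup E] [InnerProductSpace ℝ E]
    {ι : Type*} [Fintype ι] [DecidableEq ι] (e : ι → E) (P : Set E) (w : ι → ℝ)
    (hw : ∀ i, 0 ≤ w i) {ρ : ℝ} (hρ : 0 < ρ)
    (hcoord : ∀ x ∈ P, ∀ y ∈ P, ‖x - y‖ ^ 2 ≤ ∑ i, ⟪e i, x - y⟫_ℝ ^ 2)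
    (hwidth : ∀ x ∈ P, ∀ y ∈ P, ∀ i, |⟪e i, x - y⟫_ℝ| ≤ w i) :
    ∃ (J : Finset (ι → ℤ)) (φ : E → ι → ℤ), (∀ x ∈ P, φ x ∈ J) ∧
      (∀ x ∈ P, ∀ y ∈ P, φ x = φ y → ‖x - y‖ < ρ) ∧
      (J.card : ℝ) ≤ ∏ i, (2 * ((Fintype.card ι : ℝ) + 1) / ρ * w i + 2) := by
  set N : ℝ := (Fintype.card ι : ℝ) with hN
  have hN0 : 0 ≤ N := Nat.cast_nonneg _
  rcases P.eq_empty_or_nonempty with rfl | ⟨x₀, hx₀⟩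
  · refine ⟨∅, fun _ _ => 0, by simp, by simp, ?_⟩
    simp only [Finset.card_empty, Nat.cast_zero]
    exact Finset.prod_nonneg fun i _ => by have := hw i; positivity
  set ε : ℝ := ρ / (N + 1) with hε
  have hε0 : 0 < ε := by positivity
  refine ⟨Fintype.piFinset fun i => Finset.Icc ⌊-(w i / ε)⌋ ⌊w i / ε⌋,
    fun x i => ⌊⟪e i, x - x₀⟫_ℝ / ε⌋, ?_, ?_, ?_⟩
  · intro x hx
    rw [Fintype.mem_piFinset]
    intro i
    have := abs_le.1 (hwidth x hx x₀ hx₀ i)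
    rw [Finset.mem_Icc]
    constructor
    · apply Int.floor_mono
      rw [← neg_div]; gcongr; exact this.1
    · apply Int.floor_mono
      gcongr; exact this.2
  · intro x hx y hy hxy
    have h1 : ∀ i, ⟪e i, x - y⟫_ℝ ^ 2 ≤ ε ^ 2 := by
      intro i
      have h2 := Int.abs_sub_lt_one_of_floor_eq_floor (congrFun hxy i)
      rw [← sub_div, ← inner_sub_right, sub_sub_sub_cancel_right, abs_div, abs_of_pos hε0,
        div_lt_one hε0] at h2
      rw [← sq_abs]
      gcongr
    have h3 : ‖x - y‖ ^ 2 ≤ N * ε ^ 2 := (hcoord x hx y hy).trans <| by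
      calc _ ≤ ∑ _i : ι, ε ^ 2 := Finset.sum_le_sum fun i _ => h1 i
        _ = _ := by simp [hN]
    have h4 : N * ε ^ 2 < ρ ^ 2 := by
      have : ρ = (N + 1) * ε := by rw [hε]; field_simp
      rw [this]
      nlinarith [sq_nonneg ε, pow_pos hε0 2, mul_nonneg hN0 (sq_nonneg ε),
        mul_nonneg (mul_nonneg hN0 hN0) (sq_nonneg ε)]
    exact lt_of_pow_lt_pow_left₀ 2 hρ.le (h3.trans_lt h4)
  · rw [Fintype.card_piFinset, Nat.cast_prod]
    refine Finset.prod_le_prod (fun _ _ => Nat.cast_nonneg _) fun i _ => ?_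
    have hwi : 0 ≤ w i / ε := div_nonneg (hw i) hε0.le
    rw [Int.card_Icc]
    have h0 : ⌊-(w i / ε)⌋ ≤ ⌊w i / ε⌋ := Int.floor_mono (by linarith)
    have h1 : (((⌊w i / ε⌋ + 1 - ⌊-(w i / ε)⌋).toNat : ℤ) : ℝ) =
        (⌊w i / ε⌋ : ℝ) + 1 - ⌊-(w i / ε)⌋ := by
      rw [Int.toNat_of_nonneg (by linarith)]; push_cast; ring
    rw [Int.cast_natCast] at h1
    rw [h1]
    have h2 := Int.floor_le (w i / ε)
    have h3 := Int.lt_floor_add_one (-(w i / ε))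
    have h4 : 2 * (N + 1) / ρ * w i = 2 * (w i / ε) := by rw [hε]; field_simp
    linarith

theorem ncard_le_prod_of_width {E : Type*} [NormedAddCommGroup E] [InnerProductSpace ℝ E]
    {ι : Type*} [Fintype ι] [DecidableEq ι] (e : ι → E) (P : Set E) (w : ι → ℝ)
    (hw : ∀ i, 0 ≤ w i) {r : ℝ} (hr : 0 < r)
    (hsep : ∀ x ∈ P, ∀ y ∈ P, x ≠ y → r ≤ ‖x - y‖)
    (hcoord : ∀ x ∈ P, ∀ y ∈ P, ‖x - y‖ ^ 2 ≤ ∑ i, ⟪e i, x - y⟫_ℝ ^ 2)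
    (hwidth : ∀ x ∈ P, ∀ y ∈ P, ∀ i, |⟪e i, x - y⟫_ℝ| ≤ w i) :
    P.Finite ∧ (P.ncard : ℝ) ≤
      (2 * ((Fintype.card ι : ℝ) + 1) / r + 2) ^ Fintype.card ι * ∏ i, (w i + 1) := by
  obtain ⟨J, φ, hJ, hφ, hcard⟩ := exists_cell_map e P w hw hr hcoord hwidth
  have hinj : Set.InjOn φ P := by
    intro x hx y hy hxy
    by_contra hne
    exact absurd (hφ x hx y hy hxy) (not_lt.2 (hsep x hx y hy hne))
  have hmaps : Set.MapsTo φ P (J : Set (ι → ℤ)) := fun x hx => hJ x hx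
  refine ⟨Set.Finite.of_injOn hmaps hinj J.finite_toSet, ?_⟩
  have h1 : P.ncard ≤ J.card := by
    have := Set.ncard_le_ncard_of_injOn φ hmaps hinj J.finite_toSet
    rwa [Set.ncard_coe_finset] at this
  calc (P.ncard : ℝ) ≤ J.card := by exact_mod_cast h1
    _ ≤ _ := hcard
    _ ≤ ∏ i, ((2 * ((Fintype.card ι : ℝ) + 1) / r + 2) * (w i + 1)) := by
      refine Finset.prod_le_prod (fun i _ => ?_) fun i _ => ?_
      · have := hw i; positivity
      · have := hw i
        have h5 : 0 ≤ 2 * ((Fintype.card ι : ℝ) + 1) / r := by positivity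
        nlinarith
    _ = _ := by rw [Finset.prod_mul_distrib, Finset.prod_const, Finset.card_univ]

/-- The coordinates of a vector of `W` in an orthonormal basis of `W` compute its norm. -/
theorem norm_sq_eq_sum_coe_inner {E : Type*} [NormedAddCommGroup E] [InnerProductSpace ℝ E]
    {W : Submodule ℝ E} {ι : Type*} [Fintype ι] (e : OrthonormalBasis ι ℝ W) {x : E}
    (hx : x ∈ W) : ‖x‖ ^ 2 = ∑ i, ⟪(e i : E), x⟫_ℝ ^ 2 := by
  have := e.sum_sq_inner_right ⟨x, hx⟩
  simpa using this.symm

theorem ncard_le_of_sub_mem {E : Type*} [NormedAddCommGroup E] [InnerProductSpace ℝ E]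
    (W : Submodule ℝ E) [FiniteDimensional ℝ W] (P : Set E) {r D : ℝ} (hr : 0 < r) (hD : 0 ≤ D)
    (hsep : ∀ x ∈ P, ∀ y ∈ P, x ≠ y → r ≤ ‖x - y‖)
    (hW : ∀ x ∈ P, ∀ y ∈ P, x - y ∈ W) (hdiam : ∀ x ∈ P, ∀ y ∈ P, ‖x - y‖ ≤ D) :
    P.Finite ∧ (P.ncard : ℝ) ≤
      (2 * ((Module.finrank ℝ W : ℝ) + 1) / r + 2) ^ Module.finrank ℝ W *
        (D + 1) ^ Module.finrank ℝ W := by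
  have h := ncard_le_prod_of_width (fun i => (stdOrthonormalBasis ℝ W i : E)) P (fun _ => D)
    (fun _ => hD) hr hsep
    (fun x hx y hy => (norm_sq_eq_sum_coe_inner (stdOrthonormalBasis ℝ W) (hW x hx y hy)).le)
    (fun x hx y hy i => ?_)
  · simpa using h
  · refine (abs_real_inner_le_norm _ _).trans ?_
    have : ‖(stdOrthonormalBasis ℝ W i : E)‖ = 1 := (stdOrthonormalBasis ℝ W).norm_eq_one i
    rw [this, one_mul]; exact hdiam x hx y hy

/-- An orthonormal basis of `W` with a prescribed member. -/
theorem exists_orthonormalBasis_apply_eq {W : Type*} [NormedAddCommGroup W]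
    [InnerProductSpace ℝ W] [FiniteDimensional ℝ W] {d : ℕ} (hd : Module.finrank ℝ W = d)
    {w : W} (hw : ‖w‖ = 1) :
    ∃ (e : OrthonormalBasis (Fin d) ℝ W) (i₀ : Fin d), e i₀ = w := by
  subst hd
  have : 0 < Module.finrank ℝ W := by
    have : Nontrivial W := ⟨w, 0, by rintro rfl; simp at hw⟩
    exact Module.finrank_pos
  have hv : Orthonormal ℝ (Set.domRestrict {(⟨0, this⟩ : Fin (Module.finrank ℝ W))}
      (fun _ => w)) := by
    constructor
    · intro i; exact hw
    · intro i j hij; exact absurd (Subsingleton.elim i j) hij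
  obtain ⟨e, he⟩ := hv.exists_orthonormalBasis_extension_of_card_eq (by simp)
  exact ⟨e, _, he _ rfl⟩

theorem prod_ite_width {d : ℕ} (i₀ : Fin d) (A D : ℝ) :
    ∏ i, ((if i = i₀ then A else D) + 1) = (A + 1) * (D + 1) ^ (d - 1) := by
  rw [← Finset.mul_prod_erase _ _ (Finset.mem_univ i₀)]
  rw [Finset.prod_congr rfl (g := fun _ => D + 1)]
  · simp [Finset.card_erase_of_mem]
  · intro i hi
    simp [Finset.ne_of_mem_erase hi]

/-- Points of a coset of `W` that are confined to a thin slab orthogonal to `w ∈ W`. -/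
theorem ncard_le_of_slab {E : Type*} [NormedAddCommGroup E] [InnerProductSpace ℝ E]
    (W : Submodule ℝ E) [FiniteDimensional ℝ W] {d : ℕ} (hd : Module.finrank ℝ W = d)
    {w : E} (hwW : w ∈ W) (hw : ‖w‖ = 1)
    (P : Set E) {r A D : ℝ} (hr : 0 < r) (hA : 0 ≤ A) (hD : 0 ≤ D)
    (hsep : ∀ x ∈ P, ∀ y ∈ P, x ≠ y → r ≤ ‖x - y‖)
    (hW : ∀ x ∈ P, ∀ y ∈ P, x - y ∈ W) (hdiam : ∀ x ∈ P, ∀ y ∈ P, ‖x - y‖ ≤ D)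
    (hslab : ∀ x ∈ P, ∀ y ∈ P, |⟪w, x - y⟫_ℝ| ≤ A) :
    (P.ncard : ℝ) ≤ (2 * ((d : ℝ) + 1) / r + 2) ^ d * ((A + 1) * (D + 1) ^ (d - 1)) := by
  obtain ⟨e, i₀, he⟩ := exists_orthonormalBasis_apply_eq hd (w := (⟨w, hwW⟩ : W)) hw
  have h := ncard_le_prod_of_width (fun i => (e i : E)) P (fun i => if i = i₀ then A else D)
    (fun i => by split_ifs <;> assumption) hr hsep
    (fun x hx y hy => (norm_sq_eq_sum_coe_inner e (hW x hx y hy)).le)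
    (fun x hx y hy i => ?_)
  · rw [prod_ite_width] at h
    simpa using h.2
  · split_ifs with hi
    · rw [hi, he]; exact hslab x hx y hy
    · refine (abs_real_inner_le_norm _ _).trans ?_
      have : ‖(e i : E)‖ = 1 := e.norm_eq_one i
      rw [this, one_mul]; exact hdiam x hx y hy

/-- A set of separated points in a coset of a `d`-dimensional space `V` either has few points, or
differences of points at distance less than `ρ` already span `V`. -/
theorem exists_short_span {E : Type*} [NormedAddCommGroup E] [InnerProductSpace ℝ E]
    {d : ℕ} {r : ℝ} (hr : 0 < r) : ∃ C > (0 : ℝ),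
    ∀ (V : Submodule ℝ E) [FiniteDimensional ℝ V], Module.finrank ℝ V = d →
    ∀ (P : Set E) (D ρ : ℝ), 1 ≤ ρ → ρ ≤ D →
    (∀ x ∈ P, ∀ y ∈ P, x ≠ y → r ≤ ‖x - y‖) →
    (∀ x ∈ P, ∀ y ∈ P, x - y ∈ V) → (∀ x ∈ P, ∀ y ∈ P, ‖x - y‖ ≤ D) →
    C * D ^ d < P.ncard * ρ →
    Submodule.span ℝ {h | ‖h‖ ≤ ρ ∧ ∃ x ∈ P, ∃ y ∈ P, x - y = h} = V := by
  classical
  set B : ℝ := 2 * ((d : ℝ) + 1) / r + 2 with hB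
  have hB1 : 1 ≤ B := by
    have : 0 ≤ 2 * ((d : ℝ) + 1) / r := by positivity
    linarith
  set A : ℝ := 2 * ((d : ℝ) + 1) + 2 with hA
  have hA0 : 0 < A := by positivity
  refine ⟨A ^ d * (B ^ d * 2 ^ d), by positivity, ?_⟩
  intro V _ hV P D ρ hρ hρD hsep hPV hdiam hcard
  have hρ0 : 0 < ρ := by linarith
  have hD0 : 0 ≤ D := by linarith
  set U := Submodule.span ℝ {h | ‖h‖ ≤ ρ ∧ ∃ x ∈ P, ∃ y ∈ P, x - y = h} with hU
  have hUV : U ≤ V := by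
    rw [hU, Submodule.span_le]
    rintro h ⟨-, x, hx, y, hy, rfl⟩
    exact hPV x hx y hy
  by_contra hne
  have hlt : Module.finrank ℝ U < d := by
    rw [← hV]; exact Submodule.finrank_lt_finrank_of_lt (lt_of_le_of_ne hUV hne)
  have : FiniteDimensional ℝ U := Submodule.finiteDimensional_of_le hUV
  obtain ⟨hPfin, -⟩ := ncard_le_of_sub_mem V P hr hD0 hsep hPV hdiam
  let e : OrthonormalBasis (Fin d) ℝ V := (stdOrthonormalBasis ℝ V).reindex (finCongr hV)
  obtain ⟨J, φ, hJ, hφ, hJcard⟩ := exists_cell_map (fun i => (e i : E)) P (fun _ => D)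
    (fun _ => hD0) hρ0
    (fun x hx y hy => (norm_sq_eq_sum_coe_inner e (hPV x hx y hy)).le)
    (fun x hx y hy i => by
      refine (abs_real_inner_le_norm _ _).trans ?_
      have : ‖(e i : E)‖ = 1 := e.norm_eq_one i
      rw [this, one_mul]; exact hdiam x hx y hy)
  have hcell : ∀ j ∈ J, (({x ∈ hPfin.toFinset | φ x = j}.card : ℕ) : ℝ) ≤
      B ^ d * (2 * ρ) ^ (d - 1) := by
    intro j _
    have hsub : ∀ x ∈ ({x ∈ hPfin.toFinset | φ x = j} : Finset E), x ∈ P ∧ φ x = j := by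
      intro x hx; simpa using hx
    have h1 := (ncard_le_of_sub_mem U (({x ∈ hPfin.toFinset | φ x = j} : Finset E) : Set E) hr
      hρ0.le (fun x hx y hy => hsep x (hsub x hx).1 y (hsub y hy).1)
      (fun x hx y hy => Submodule.subset_span ⟨(hφ x (hsub x hx).1 y (hsub y hy).1
        ((hsub x hx).2.trans (hsub y hy).2.symm)).le, x, (hsub x hx).1, y, (hsub y hy).1, rfl⟩)
      (fun x hx y hy => (hφ x (hsub x hx).1 y (hsub y hy).1
        ((hsub x hx).2.trans (hsub y hy).2.symm)).le)).2
    rw [Set.ncard_coe_finset] at h1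
    refine h1.trans ?_
    have hle : Module.finrank ℝ U ≤ d - 1 := by omega
    have hBU : 2 * ((Module.finrank ℝ U : ℝ) + 1) / r + 2 ≤ B := by
      have : (Module.finrank ℝ U : ℝ) ≤ d := by exact_mod_cast hlt.le
      rw [hB]; gcongr
    have h2 : (2 * ((Module.finrank ℝ U : ℝ) + 1) / r + 2) ^ Module.finrank ℝ U ≤ B ^ d :=
      (pow_le_pow_left₀ (by positivity) hBU _).trans (pow_le_pow_right₀ hB1 hlt.le)
    have h3 : (ρ + 1) ^ Module.finrank ℝ U ≤ (2 * ρ) ^ (d - 1) :=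
      (pow_le_pow_left₀ (by positivity) (by linarith) _).trans
        (pow_le_pow_right₀ (by linarith) hle)
    gcongr
  have hsum : (P.ncard : ℝ) ≤ J.card * (B ^ d * (2 * ρ) ^ (d - 1)) := by
    rw [Set.ncard_eq_toFinset_card P hPfin,
      Finset.card_eq_sum_card_fiberwise (f := φ) (t := J) (fun x hx => hJ x (by simpa using hx)),
      Nat.cast_sum, ← nsmul_eq_mul]
    exact Finset.sum_le_card_nsmul _ _ _ hcell
  have hJ2 : (J.card : ℝ) ≤ (A * (D / ρ)) ^ d := by
    refine hJcard.trans ?_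
    rw [Finset.prod_const, Finset.card_univ, Fintype.card_fin]
    refine pow_le_pow_left₀ (by positivity) ?_ _
    have h1 : 1 ≤ D / ρ := by rwa [one_le_div hρ0]
    have h2 : 2 * ((d : ℝ) + 1) / ρ * D = 2 * ((d : ℝ) + 1) * (D / ρ) := by ring
    rw [h2, hA]; nlinarith
  have hfin : (P.ncard : ℝ) * ρ ≤ A ^ d * (B ^ d * 2 ^ d) * D ^ d := by
    calc (P.ncard : ℝ) * ρ ≤ (A * (D / ρ)) ^ d * (B ^ d * (2 * ρ) ^ (d - 1)) * ρ := by
          gcongr; exact hsum.trans (by gcongr)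
      _ ≤ (A * (D / ρ)) ^ d * (B ^ d * (2 * ρ) ^ (d - 1)) * (2 * ρ) := by gcongr; linarith
      _ = (A * (D / ρ)) ^ d * (B ^ d * ((2 * ρ) ^ (d - 1) * (2 * ρ))) := by ring
      _ = (A * (D / ρ)) ^ d * (B ^ d * (2 * ρ) ^ d) := by
          rw [← pow_succ, Nat.sub_add_cancel (by omega)]
      _ = _ := by rw [mul_pow, mul_pow, div_pow]; field_simp
  linarith

/-! ### Lattice points in boxes -/

theorem Box.abs_inner_sub_le {n : ℕ} (Q : Box n) {x y : Euc n} (hx : x ∈ Q.points)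
    (hy : y ∈ Q.points) (i : Fin n) : |⟪Q.axis i, x - y⟫_ℝ| ≤ Q.side i := by
  have h1 := abs_le.1 (hx i)
  have h2 := abs_le.1 (hy i)
  have h3 : x - y = (x - Q.center) - (y - Q.center) := by abel
  rw [h3, inner_sub_right, abs_le]
  constructor <;> linarith

theorem volume_setOf_abs_inner_le {n : ℕ} (e : OrthonormalBasis (Fin n) ℝ (Euc n)) (c : Euc n)
    (w : Fin n → ℝ) :
    MeasurableSet {y : Euc n | ∀ i, |⟪e i, y - c⟫_ℝ| ≤ w i} ∧
    volume {y : Euc n | ∀ i, |⟪e i, y - c⟫_ℝ| ≤ w i} = ∏ i, ENNReal.ofReal (2 * w i) := by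
  let I : Set (Fin n → ℝ) := Set.Icc (fun i => ⟪e i, c⟫_ℝ - w i) (fun i => ⟪e i, c⟫_ℝ + w i)
  have hI : MeasurableSet I := measurableSet_Icc
  let ψ := (MeasurableEquiv.toLp 2 (Fin n → ℝ)).symm
  have hψ : MeasurePreserving ψ volume volume :=
    EuclideanSpace.volume_preserving_symm_measurableEquiv_toLp (Fin n)
  have hmp : MeasurePreserving (ψ ∘ e.repr) volume volume := hψ.comp e.measurePreserving_repr
  have hset : {y : Euc n | ∀ i, |⟪e i, y - c⟫_ℝ| ≤ w i} = (ψ ∘ e.repr) ⁻¹' I := by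
    ext y
    have h0 : ∀ i, (ψ ∘ e.repr) y i = ⟪e i, y⟫_ℝ := fun i => e.repr_apply_apply y i
    simp only [Set.mem_ofPred_eq, Set.mem_preimage, I, Set.mem_Icc, Pi.le_def, h0, inner_sub_right,
      abs_le, ← forall_and]
    exact forall_congr' fun i => by constructor <;> rintro ⟨h1, h2⟩ <;> constructor <;> linarith
  rw [hset]
  refine ⟨hmp.measurable hI, ?_⟩
  rw [hmp.measure_preimage hI.nullMeasurableSet, Real.volume_Icc_pi]
  exact Finset.prod_congr rfl fun i _ => by congr 1; ring

/-- A box whose lattice points affinely span the whole space has at most as many of them as its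
volume allows. The reduction modulo the sublattice spanned by `n` independent differences of these
points maps a small ball into a set that is not wider than `n` times the box, so that the translates
of this set by the lattice points of the box stay in a dilate of the box; the lattice translates of
the ball are disjoint. -/
theorem ncard_le_volume_of_vectorSpan_eq_top (n : ℕ) {r : ℝ} (hr : 0 < r) :
    ∃ C > (0 : ℝ), ∀ (Λ : AddSubgroup (Euc n)), (∀ x ∈ Λ, x ≠ 0 → r ≤ ‖x‖) →
      ∀ (Q : Box n), (∀ i, 0 ≤ Q.side i) → vectorSpan ℝ (Q.points ∩ Λ) = ⊤ →
        ((Q.points ∩ Λ).ncard : ℝ) ≤ C * ∏ i, Q.side i := by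
  classical
  set F : Set (Euc n) := Metric.ball 0 (r / 2) with hF
  have hF0 : 0 < volume F := Metric.measure_ball_pos _ _ (by positivity)
  have hFtop : volume F ≠ ⊤ := measure_ball_lt_top.ne
  have hFr : 0 < (volume F).toReal := ENNReal.toReal_pos hF0.ne' hFtop
  have hFm : MeasurableSet F := measurableSet_ball
  refine ⟨(2 * (n : ℝ) + 1) ^ n / (volume F).toReal, by positivity, ?_⟩
  intro Λ hsep Q hside hspan
  have hsep' : ∀ x ∈ Λ, ∀ y ∈ Λ, x ≠ y → r ≤ ‖x - y‖ := fun x hx y hy hxy =>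
    hsep _ (Λ.sub_mem hx hy) (sub_ne_zero.2 hxy)
  set P : Set (Euc n) := Q.points ∩ Λ with hP
  have hdiff : ∀ x ∈ P, ∀ y ∈ P, ∀ i, |⟪Q.axis i, x - y⟫_ℝ| ≤ Q.side i :=
    fun x hx y hy => Q.abs_inner_sub_le hx.1 hy.1
  have hPfin : P.Finite := (ncard_le_prod_of_width Q.axis P Q.side hside hr
    (fun x hx y hy => hsep' x hx.2 y hy.2) (fun x _ y _ => (Q.axis.sum_sq_inner_right _).ge)
    hdiff).1
  -- a basis consisting of differences of lattice points of the box
  obtain ⟨f, hfmem, hfspan, hfli⟩ := Submodule.exists_fun_fin_finrank_span_eq ℝ (P -ᵥ P)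
  replace hfspan : Submodule.span ℝ (Set.range f) = ⊤ :=
    hfspan.trans (by rw [← vectorSpan_def, hspan])
  let h := Module.Basis.mk hfli hfspan.ge
  have hcard : Module.finrank ℝ (Submodule.span ℝ (P -ᵥ P)) = n := by
    rw [← vectorSpan_def, hspan, finrank_top]; simp
  have hh : ∀ i, h i = f i := fun i => Module.Basis.mk_apply _ _ i
  have hwidth : ∀ i j, |⟪Q.axis j, h i⟫_ℝ| ≤ Q.side j := by
    intro i j
    obtain ⟨x, hx, y, hy, hxy⟩ := hfmem i
    rw [hh, ← hxy]; exact hdiff x hx y hy j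
  have hfloor : ∀ x, (ZSpan.floor h x : Euc n) ∈ Λ := by
    intro x
    have hle : Submodule.span ℤ (Set.range h) ≤ AddSubgroup.toIntSubmodule Λ := by
      rw [Submodule.span_le]
      rintro _ ⟨i, rfl⟩
      obtain ⟨x, hx, y, hy, hxy⟩ := hfmem i
      rw [hh, ← hxy]; exact Λ.sub_mem hx.2 hy.2
    exact hle (ZSpan.floor h x).2
  have hfract : ∀ x j, |⟪Q.axis j, ZSpan.fract h x⟫_ℝ| ≤ n * Q.side j := by
    intro x j
    rw [← h.sum_repr (ZSpan.fract h x), inner_sum]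
    refine (Finset.abs_sum_le_sum_abs _ _).trans ?_
    calc _ ≤ ∑ _i : Fin (Module.finrank ℝ (Submodule.span ℝ (P -ᵥ P))), Q.side j := by
          refine Finset.sum_le_sum fun i _ => ?_
          rw [inner_smul_right, abs_mul, ZSpan.repr_fract_apply, abs_of_nonneg (Int.fract_nonneg _)]
          exact (mul_le_of_le_one_left (abs_nonneg _) (Int.fract_lt_one _).le).trans (hwidth i j)
      _ = _ := by simp [hcard]
  set W : Set (Euc n) := {y | ∀ i, |⟪Q.axis i, y - Q.center⟫_ℝ| ≤ ((n : ℝ) + 1 / 2) * Q.side i}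
    with hW
  obtain ⟨hWm, hWvol⟩ := volume_setOf_abs_inner_le Q.axis Q.center
    (fun i => ((n : ℝ) + 1 / 2) * Q.side i)
  have hPW : ∀ k ∈ P, ∀ x, k + ZSpan.fract h x ∈ W := by
    intro k hk x i
    have h1 := hk.1 i
    have h2 := hfract x i
    have h3 : k + ZSpan.fract h x - Q.center = (k - Q.center) + ZSpan.fract h x := by abel
    rw [h3, inner_add_right]
    refine (abs_add_le _ _).trans ?_
    linarith
  set G : Set (Euc n) := {g | g ∈ Λ ∧ ∃ x ∈ F, g + x ∈ W} with hG
  have hGfin : G.Finite := by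
    refine (ncard_le_prod_of_width Q.axis G (fun i => (2 * (n : ℝ) + 1) * Q.side i + r)
      (fun i => by have := hside i; positivity) hr
      (fun x hx y hy => hsep' x hx.1 y hy.1)
      (fun x _ y _ => (Q.axis.sum_sq_inner_right _).ge) ?_).1
    rintro g ⟨-, x, hx, hgx⟩ g' ⟨-, x', hx', hgx'⟩ i
    have h1 := abs_le.1 (hgx i)
    have h2 := abs_le.1 (hgx' i)
    have hnorm : ∀ z ∈ F, |⟪Q.axis i, z⟫_ℝ| ≤ r / 2 := by
      intro z hz
      refine (abs_real_inner_le_norm _ _).trans ?_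
      rw [Q.axis.norm_eq_one, one_mul]
      rw [hF, mem_ball_zero_iff] at hz; exact hz.le
    have h3 := abs_le.1 (hnorm x hx)
    have h4 := abs_le.1 (hnorm x' hx')
    have h5 : g - g' = ((g + x - Q.center) - (g' + x' - Q.center)) - (x - x') := by abel
    rw [h5, inner_sub_right, inner_sub_right _ (g + x - Q.center), inner_sub_right _ x, abs_le]
    constructor <;> linarith
  let A : Euc n → Set (Euc n) := fun g => {y | y - g ∈ F} ∩ W
  have hAm : ∀ g, MeasurableSet (A g) := fun g =>
    (hFm.preimage (measurable_id.sub_const g)).inter hWm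
  have hdisj : (hGfin.toFinset : Set (Euc n)).PairwiseDisjoint A := by
    intro g hg g' hg' hne
    rw [Function.onFun, Set.disjoint_left]
    rintro y ⟨hy, -⟩ ⟨hy', -⟩
    have hgΛ : g ∈ Λ := by have : g ∈ G := by simpa using hg
                           exact this.1
    have hgΛ' : g' ∈ Λ := by have : g' ∈ G := by simpa using hg'
                             exact this.1
    have h1 := hsep' g' hgΛ' g hgΛ hne.symm
    have h2 : ‖y - g‖ < r / 2 := by simpa [hF] using hy
    have h3 : ‖y - g'‖ < r / 2 := by simpa [hF] using hy'
    have h4 : g' - g = (y - g) - (y - g') := by abel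
    rw [h4] at h1
    have := norm_sub_le (y - g) (y - g')
    linarith
  have hAvol : ∀ g, volume (A g) = ∫⁻ x in F, ({x | g + x ∈ W} : Set (Euc n)).indicator 1 x := by
    intro g
    have hm : MeasurableSet ({x | g + x ∈ W} : Set (Euc n)) :=
      hWm.preimage (measurable_const_add g)
    rw [lintegral_indicator_one hm, Measure.restrict_apply hm, ← measure_preimage_add volume g]
    congr 1
    ext x
    simp only [A, Set.mem_preimage, Set.mem_inter_iff, Set.mem_ofPred_eq, add_sub_cancel_left]
    exact and_comm
  have hpt : ∀ x ∈ F, (P.ncard : ENNReal) ≤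
      ∑ g ∈ hGfin.toFinset, ({x | g + x ∈ W} : Set (Euc n)).indicator 1 x := by
    intro x hx
    have hinj : Set.InjOn (fun k => k - (ZSpan.floor h x : Euc n)) P :=
      fun a _ b _ hab => sub_left_injective hab
    have hin : ∀ k ∈ P, k - (ZSpan.floor h x : Euc n) + x ∈ W := by
      intro k hk
      have := hPW k hk x
      rw [ZSpan.fract_apply] at this
      convert this using 1; abel
    have h1 : P.ncard ≤ (hGfin.toFinset.filter fun g => g + x ∈ W).card := by
      rw [← Set.ncard_coe_finset]
      refine Set.ncard_le_ncard_of_injOn _ ?_ hinj (Finset.finite_toSet _)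
      intro k hk
      simp only [Finset.coe_filter, Set.Finite.mem_toFinset, Set.mem_ofPred_eq]
      exact ⟨⟨Λ.sub_mem hk.2 (hfloor x), x, hx, hin k hk⟩, hin k hk⟩
    calc (P.ncard : ENNReal) ≤ ((hGfin.toFinset.filter fun g => g + x ∈ W).card : ENNReal) := by
          exact_mod_cast h1
      _ = _ := by
          rw [Finset.card_filter]; push_cast
          exact Finset.sum_congr rfl fun g _ => by simp [Set.indicator_apply]
  -- for `x` in the ball, the `P.ncard` points `k + fract x` are lattice translates of `x` in `W`
  have hmain : (P.ncard : ENNReal) * volume F ≤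
      ∏ i, ENNReal.ofReal (2 * (((n : ℝ) + 1 / 2) * Q.side i)) := by
    rw [← hWvol]
    calc (P.ncard : ENNReal) * volume F = ∫⁻ _x in F, (P.ncard : ENNReal) := by simp
      _ ≤ ∫⁻ x in F, ∑ g ∈ hGfin.toFinset,
            ({x | g + x ∈ W} : Set (Euc n)).indicator 1 x := setLIntegral_mono' hFm hpt
      _ = ∑ g ∈ hGfin.toFinset, volume (A g) := by
          rw [lintegral_finsetSum]
          · exact Finset.sum_congr rfl fun g _ => (hAvol g).symm
          · intro g _
            exact measurable_one.indicator (hWm.preimage (measurable_const_add g))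
      _ = volume (⋃ g ∈ hGfin.toFinset, A g) :=
          (measure_biUnion_finset hdisj fun g _ => hAm g).symm
      _ ≤ volume W := measure_mono (Set.iUnion₂_subset fun g _ => Set.inter_subset_right)
  rw [← ENNReal.ofReal_prod_of_nonneg (fun i _ => by have := hside i; positivity)] at hmain
  have h6 := ENNReal.toReal_mono ENNReal.ofReal_ne_top hmain
  rw [ENNReal.toReal_mul, ENNReal.toReal_natCast, ENNReal.toReal_ofReal
    (Finset.prod_nonneg fun i _ => by have := hside i; positivity)] at h6
  have h7 : ∏ i, (2 * (((n : ℝ) + 1 / 2) * Q.side i)) = (2 * (n : ℝ) + 1) ^ n * ∏ i, Q.side i := by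
    rw [← Fin.prod_const, ← Finset.prod_mul_distrib]
    exact Finset.prod_congr rfl fun i _ => by ring
  rw [h7] at h6
  rw [div_mul_eq_mul_div, le_div_iff₀ hFr]
  exact h6

/-- The lattice of frequencies as a group. -/
def frequencyGroup {n : ℕ} (b : Module.Basis (Fin n) ℝ (Euc n)) : AddSubgroup (Euc n) where
  carrier := frequencyLattice b
  zero_mem' := ⟨0, fun i => ⟨0, by simp⟩, by simp⟩
  add_mem' := by
    rintro _ _ ⟨k, hk, rfl⟩ ⟨l, hl, rfl⟩
    refine ⟨k + l, fun i => ?_, by simp⟩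
    obtain ⟨p, hp⟩ := hk i
    obtain ⟨q, hq⟩ := hl i
    exact ⟨p + q, by rw [inner_add_left, hp, hq]; push_cast; ring⟩
  neg_mem' := by
    rintro _ ⟨k, hk, rfl⟩
    refine ⟨-k, fun i => ?_, by simp⟩
    obtain ⟨p, hp⟩ := hk i
    exact ⟨-p, by rw [inner_neg_left, hp]; push_cast; ring⟩

theorem coe_frequencyGroup {n : ℕ} (b : Module.Basis (Fin n) ℝ (Euc n)) :
    (frequencyGroup b : Set (Euc n)) = frequencyLattice b := rfl

theorem exists_frequency_gap {n : ℕ} (b : Module.Basis (Fin n) ℝ (Euc n)) :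
    ∃ r > (0 : ℝ), ∀ x ∈ frequencyGroup b, x ≠ 0 → r ≤ ‖x‖ := by
  set M : ℝ := ∑ i, ‖b i‖ + 1 with hM
  have hM0 : 0 < M := by positivity
  refine ⟨2 * Real.pi / M, by positivity, ?_⟩
  rintro _ ⟨k, hk, rfl⟩ hne
  have hk0 : k ≠ 0 := by rintro rfl; simp at hne
  obtain ⟨i, hi⟩ : ∃ i, ⟪k, b i⟫_ℝ ≠ 0 := by
    by_contra! hall
    exact hk0 (InnerProductSpace.ext_inner_right_basis b fun i => by rw [hall i, inner_zero_left])
  obtain ⟨m, hm⟩ := hk i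
  have h1 : 1 ≤ |⟪k, b i⟫_ℝ| := by
    have : m ≠ 0 := by rintro rfl; exact hi (by simpa using hm)
    rw [hm]; exact_mod_cast Int.one_le_abs this
  have h2 : ‖b i‖ ≤ M := by
    have := Finset.single_le_sum (f := fun i => ‖b i‖) (fun j _ => norm_nonneg _)
      (Finset.mem_univ i)
    linarith
  have h3 : 1 ≤ ‖k‖ * M := h1.trans ((abs_real_inner_le_norm _ _).trans (by gcongr))
  change _ ≤ ‖(2 * Real.pi) • k‖
  rw [norm_smul, Real.norm_eq_abs, abs_of_pos Real.two_pi_pos, div_le_iff₀ hM0, mul_assoc]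
  exact le_mul_of_one_le_right Real.two_pi_pos.le h3

/-! ### The lattice points of a bad cap -/

theorem one_le_and_le_of_eq_rpow_half {lam δ R : ℝ} (hδ1 : δ ≤ 1) (hld : 1 ≤ lam * δ)
    (hR : R = (lam * δ) ^ (1 / 2 : ℝ)) : R ^ 2 = lam * δ ∧ 1 ≤ R ∧ δ ≤ R := by
  have h1 : 1 ≤ R := hR ▸ Real.one_le_rpow hld (by norm_num)
  refine ⟨?_, h1, hδ1.trans h1⟩
  rw [hR, ← Real.sqrt_eq_rpow, Real.sq_sqrt (by linarith)]

theorem Box.IsCap.side_nonneg {n : ℕ} {Q : Box n} {K lam δ : ℝ} (hQ : Q.IsCap K lam δ)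
    (hK : 1 ≤ K) (hδ : 0 < δ) (hld : 1 ≤ lam * δ) (i : Fin n) : 0 ≤ Q.side i := by
  rcases lt_or_eq_of_le (Nat.succ_le_of_lt i.2) with h | h
  · exact le_trans (by positivity) (hQ.long_side i h).1
  · exact le_trans (by positivity) (hQ.short_side i h).1

theorem Box.IsCap.side_le {n : ℕ} {Q : Box n} {K lam δ R : ℝ} (hQ : Q.IsCap K lam δ)
    (hK : 1 ≤ K) (hR : R = (lam * δ) ^ (1 / 2 : ℝ)) (hδR : δ ≤ R) (i : Fin n) :
    Q.side i ≤ K * R := by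
  rcases lt_or_eq_of_le (Nat.succ_le_of_lt i.2) with h | h
  · rw [hR]; exact (hQ.long_side i h).2
  · exact (hQ.short_side i h).2.trans (by gcongr)

theorem Box.IsCap.norm_sub_le {n : ℕ} {Q : Box n} {K lam δ R : ℝ} (hQ : Q.IsCap K lam δ)
    (hK : 1 ≤ K) (hR : R = (lam * δ) ^ (1 / 2 : ℝ)) (hδR : δ ≤ R)
    {x y : Euc n} (hx : x ∈ Q.points) (hy : y ∈ Q.points) : ‖x - y‖ ≤ n * K * R := by
  rw [← Q.axis.sum_repr (x - y)]
  refine (norm_sum_le _ _).trans ?_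
  calc _ ≤ ∑ _i : Fin n, K * R := by
        refine Finset.sum_le_sum fun i _ => ?_
        rw [norm_smul, Q.axis.norm_eq_one, mul_one, Real.norm_eq_abs,
          OrthonormalBasis.repr_apply_apply]
        exact (Q.abs_inner_sub_le hx hy i).trans (hQ.side_le hK hR hδR i)
    _ = _ := by simp; ring

theorem Box.IsCap.prod_side_le {n : ℕ} (hn : 1 ≤ n) {Q : Box n} {K lam δ R : ℝ}
    (hQ : Q.IsCap K lam δ) (hK : 1 ≤ K) (hδ : 0 < δ) (hld : 1 ≤ lam * δ)
    (hR : R = (lam * δ) ^ (1 / 2 : ℝ)) :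
    ∏ i, Q.side i ≤ K ^ n * R ^ (n - 1) * δ := by
  obtain ⟨m, rfl⟩ : ∃ m, n = m + 1 := ⟨n - 1, by omega⟩
  have h0 := hQ.side_nonneg hK hδ hld
  have hR0 : 0 ≤ R := hR ▸ by positivity
  rw [Fin.prod_univ_castSucc]
  calc _ ≤ (∏ _i : Fin m, (K * R)) * (K * δ) := by
        refine mul_le_mul (Finset.prod_le_prod (fun i _ => h0 _) fun i _ => ?_) ?_ (h0 _)
          (Finset.prod_nonneg fun _ _ => by positivity)
        · rw [hR]; exact (hQ.long_side _ (by simp)).2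
        · exact (hQ.short_side _ (by simp)).2
    _ = _ := by simp; ring

/-- Two points of the annulus whose radii differ by `O(δ)` have squared norms which differ by
`O(lam δ)`; as caps have diameter `O((lam δ)^{1/2})`, every chord of a cap is orthogonal to all its
points up to `O(lam δ)`. -/
theorem Box.IsCap.abs_inner_chord_le {n : ℕ} {Q : Box n} {K lam δ R : ℝ} (hQ : Q.IsCap K lam δ)
    (hK : 1 ≤ K) (hlam : 1 ≤ lam) (hδ : 0 < δ) (hδ1 : δ ≤ 1)
    (hR : R = (lam * δ) ^ (1 / 2 : ℝ)) (hδR : δ ≤ R) (hR2 : R ^ 2 = lam * δ)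
    {ξ x y : Euc n} (hξ : ξ ∈ Q.points) (hx : x ∈ Q.points) (hy : y ∈ Q.points) :
    |⟪ξ, x - y⟫_ℝ| ≤ ((n : ℝ) ^ 2 + 4) * K ^ 2 * R ^ 2 := by
  have hax : |‖x‖ - lam| < K * δ := hQ.near_sphere hx
  have hay : |‖y‖ - lam| < K * δ := hQ.near_sphere hy
  rw [abs_lt] at hax hay
  have hKδ : K * δ ≤ K * lam := by gcongr; linarith
  have hKl : lam ≤ K * lam := le_mul_of_one_le_left (by linarith) hK
  have h1 : |‖x‖ ^ 2 - ‖y‖ ^ 2| ≤ 8 * K ^ 2 * R ^ 2 := by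
    have : ‖x‖ ^ 2 - ‖y‖ ^ 2 = (‖x‖ - ‖y‖) * (‖x‖ + ‖y‖) := by ring
    rw [this, abs_mul, hR2]
    have h2 : |‖x‖ - ‖y‖| ≤ 2 * (K * δ) := by rw [abs_le]; constructor <;> linarith
    have h3 : |‖x‖ + ‖y‖| ≤ 4 * (K * lam) := by
      rw [abs_of_nonneg (by positivity)]; linarith
    calc _ ≤ 2 * (K * δ) * (4 * (K * lam)) := by gcongr
      _ = _ := by ring
  have hd : ∀ z ∈ Q.points, |⟪ξ - z, x - y⟫_ℝ| ≤ (n * K * R) ^ 2 := by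
    intro z hz
    refine (abs_real_inner_le_norm _ _).trans ?_
    rw [sq]
    have := hQ.norm_sub_le hK hR hδR hξ hz
    have := hQ.norm_sub_le hK hR hδR hx hy
    exact mul_le_mul ‹_› ‹_› (norm_nonneg _) ((norm_nonneg _).trans ‹_›)
  have h4 : 2 * ⟪ξ, x - y⟫_ℝ = (‖x‖ ^ 2 - ‖y‖ ^ 2) + ⟪ξ - x, x - y⟫_ℝ + ⟪ξ - y, x - y⟫_ℝ := by
    rw [← real_inner_self_eq_norm_sq, ← real_inner_self_eq_norm_sq]
    simp only [inner_sub_left, inner_sub_right]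
    rw [real_inner_comm x y]; ring
  have h5 := abs_le.1 h1
  have h6 := abs_le.1 (hd x hx)
  have h7 := abs_le.1 (hd y hy)
  rw [abs_le]
  constructor <;> nlinarith

/-- Many separated points in a coset of a hyperplane `V` force every vector which is almost
orthogonal to their differences to be almost orthogonal to `V`. -/
theorem exists_abs_inner_le_of_ncard {E : Type*} [NormedAddCommGroup E] [InnerProductSpace ℝ E]
    (d : ℕ) (hd : 1 ≤ d) {r c D B : ℝ} (hr : 0 < r) (hc : 0 < c) (hD : 0 ≤ D) (hB : 0 ≤ B) :
    ∃ C ≥ (1 : ℝ), ∀ (V : Submodule ℝ E) [FiniteDimensional ℝ V], Module.finrank ℝ V = d →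
      ∀ (P : Set E) (R q : ℝ), 1 ≤ R → 1 ≤ q → C * q ≤ R →
      (∀ x ∈ P, ∀ y ∈ P, x ≠ y → r ≤ ‖x - y‖) →
      (∀ x ∈ P, ∀ y ∈ P, x - y ∈ V) → (∀ x ∈ P, ∀ y ∈ P, ‖x - y‖ ≤ D * R) →
      c * R ^ d ≤ q * P.ncard →
      ∀ ξ, (∀ x ∈ P, ∀ y ∈ P, |⟪ξ, x - y⟫_ℝ| ≤ B * R ^ 2) →
      ∀ w ∈ V, |⟪w, ξ⟫_ℝ| ≤ C * (R * q) * ‖w‖ := by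
  set M : ℝ := (2 * ((d : ℝ) + 1) / r + 2) ^ d * ((B + 1) * (D + 1) ^ (d - 1)) with hM
  have hM0 : 0 < M := by positivity
  refine ⟨M / c + 1, by have : 0 < M / c := by positivity
                        linarith, ?_⟩
  set C : ℝ := M / c + 1 with hC
  have hC0 : 0 < C := by positivity
  have hMC : M < c * C := by
    have : c * C = M + c := by rw [hC]; field_simp
    linarith
  intro V _ hV P R q hR hq hCR hsep hPV hdiam hbad ξ hξ w hw
  have hq0 : 0 < q := by linarith
  have hR0 : 0 < R := by linarith
  set p : E := V.starProjection ξ with hp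
  have hpV : p ∈ V := V.starProjection_apply_mem ξ
  have hinner : ∀ v ∈ V, ⟪v, ξ⟫_ℝ = ⟪v, p⟫_ℝ := by
    intro v hv
    have h : ξ - p ∈ Vᗮ := V.sub_starProjection_mem_orthogonal ξ
    have := (V.mem_orthogonal _).1 h v hv
    rw [inner_sub_right] at this; linarith
  rw [hinner w hw]
  -- if the component `p` of `ξ` in `V` is large, then `P` lies in a thin slab orthogonal to `p`
  suffices hpn : ‖p‖ ≤ C * (R * q) by
    refine (abs_real_inner_le_norm _ _).trans ?_
    rw [mul_comm]; gcongr
  by_contra! hlt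
  have hp0 : 0 < ‖p‖ := lt_trans (by positivity) hlt
  have hslab : ∀ x ∈ P, ∀ y ∈ P, |⟪‖p‖⁻¹ • p, x - y⟫_ℝ| ≤ B * R / (C * q) := by
    intro x hx y hy
    rw [inner_smul_left, RCLike.conj_to_real, abs_mul, abs_of_pos (inv_pos.2 hp0), inv_mul_le_iff₀ hp0,
      real_inner_comm, ← hinner _ (hPV x hx y hy), real_inner_comm]
    calc _ ≤ B * R ^ 2 := hξ x hx y hy
      _ = C * (R * q) * (B * R / (C * q)) := by field_simp
      _ ≤ _ := by gcongr
  have hcount := ncard_le_of_slab V hV (V.smul_mem _ hpV)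
    (by rw [norm_smul, norm_inv, norm_norm, inv_mul_cancel₀ hp0.ne']) P hr
    (A := B * R / (C * q)) (by positivity) (by positivity : 0 ≤ D * R) hsep hPV hdiam hslab
  have hA : B * R / (C * q) + 1 ≤ (B + 1) * R / (C * q) := by
    have : 1 ≤ R / (C * q) := by rwa [one_le_div (by positivity)]
    have h2 : (B + 1) * R / (C * q) = B * R / (C * q) + R / (C * q) := by ring
    linarith
  have hDR : (D * R + 1) ^ (d - 1) ≤ (D + 1) ^ (d - 1) * R ^ (d - 1) := by
    rw [← mul_pow]
    exact pow_le_pow_left₀ (by positivity) (by linarith) _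
  have h3 : c * R ^ d * C ≤ M * R ^ d := by
    calc c * R ^ d * C ≤ q * P.ncard * C := by gcongr
      _ ≤ q * ((2 * ((d : ℝ) + 1) / r + 2) ^ d *
          ((B + 1) * R / (C * q) * ((D + 1) ^ (d - 1) * R ^ (d - 1)))) * C := by
            gcongr
            exact hcount.trans (by gcongr)
      _ = M * (R ^ (d - 1) * R) := by rw [hM]; field_simp
      _ = _ := by rw [← pow_succ, Nat.sub_add_cancel hd]
  have hRd : 0 < R ^ d := by positivity
  nlinarith

theorem exists_fin_span_eq {E : Type*} [AddCommGroup E] [Module ℝ E] [FiniteDimensional ℝ E]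
    {V : Submodule ℝ E} {d : ℕ} (hd : Module.finrank ℝ V = d) {S : Set E}
    (hS : Submodule.span ℝ S = V) :
    ∃ f : Fin d → E, (∀ i, f i ∈ S) ∧ Submodule.span ℝ (Set.range f) = V := by
  subst hS hd
  obtain ⟨f, hf, hfs, -⟩ := Submodule.exists_fun_fin_finrank_span_eq ℝ S
  exact ⟨f, hf, hfs⟩

/-- The geometry of a bad cap of size `R = (lam δ)^{1/2}` which has at least `c R^{n-1} / q` lattice
points: they span a hyperplane, which has a basis of lattice vectors of length `O(q)`, and to which
the points of the cap are orthogonal up to `O(R q)`. -/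
theorem exists_badCap_structure (n : ℕ) (hn : 2 ≤ n) (b : Module.Basis (Fin n) ℝ (Euc n))
    {K c : ℝ} (hK : 1 ≤ K) (hc : 0 < c) :
    ∃ C ≥ (1 : ℝ), ∀ (lam δ R q : ℝ), 1 ≤ lam → 0 < δ → δ ≤ 1 → 1 ≤ lam * δ →
      R = (lam * δ) ^ (1 / 2 : ℝ) → 1 ≤ q → C * q ≤ R →
      ∀ Q : Box n, Q.IsCap K lam δ → c * R ^ (n - 1) ≤ q * Q.count b →
        (Q.latticeDim b = n - 1 ∨ C * (q * δ) < 1) →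
        Q.latticeDim b = n - 1 ∧
        (∀ ξ ∈ Q.points, ∀ w ∈ vectorSpan ℝ (Q.points ∩ frequencyLattice b),
          |⟪w, ξ⟫_ℝ| ≤ C * (R * q) * ‖w‖) ∧
        ∃ f : Fin (n - 1) → Euc n, (∀ i, f i ∈ frequencyLattice b ∧ ‖f i‖ ≤ C * q) ∧
          Submodule.span ℝ (Set.range f) =
            vectorSpan ℝ (Q.points ∩ frequencyLattice b) := by
  obtain ⟨r, hr, hgap⟩ := exists_frequency_gap b
  obtain ⟨C₁, hC₁, hvol⟩ := ncard_le_volume_of_vectorSpan_eq_top n hr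
  obtain ⟨C₂, hC₂, htube⟩ := exists_abs_inner_le_of_ncard (E := Euc n) (n - 1) (by omega) hr hc
    (D := n * K) (B := ((n : ℝ) ^ 2 + 4) * K ^ 2) (by positivity) (by positivity)
  obtain ⟨C₃, hC₃, hshort⟩ := exists_short_span (E := Euc n) (d := n - 1) hr
  set M₀ : ℝ := (2 * ((n : ℝ) + 1) / r + 2) ^ n * (n * K + 1) ^ n with hM₀
  have hM₀0 : 0 < M₀ := by positivity
  set M₃ : ℝ := C₃ * (n * K) ^ (n - 1) with hM₃
  have hM₃0 : 0 < M₃ := by positivity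
  set C : ℝ := M₀ / c + C₁ * K ^ n / c + C₂ + M₃ / c + 1 with hC
  have hp0 : 0 < M₀ / c := by positivity
  have hp1 : 0 < C₁ * K ^ n / c := by positivity
  have hp3 : 0 < M₃ / c := by positivity
  have hCC₂ : C₂ ≤ C := by linarith
  have hCM₀ : M₀ < c * C := by
    have : c * (M₀ / c) = M₀ := by field_simp
    nlinarith
  have hCM₁ : C₁ * K ^ n ≤ c * C := by
    have : c * (C₁ * K ^ n / c) = C₁ * K ^ n := by field_simp
    nlinarith
  have hCM₃ : M₃ < c * C := by
    have : c * (M₃ / c) = M₃ := by field_simp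
    nlinarith
  have hC1 : 1 ≤ C := by linarith
  clear_value C M₀ M₃
  have hC0 : 0 < C := by linarith
  refine ⟨C, hC1, ?_⟩
  intro lam δ R q hlam hδ hδ1 hld hR hq hCqR Q hQ hbad hdim
  have hq0 : 0 < q := by linarith
  obtain ⟨hR2, hR1, hδR⟩ := one_le_and_le_of_eq_rpow_half hδ1 hld hR
  have hR0 : 0 < R := by linarith
  set P : Set (Euc n) := Q.points ∩ frequencyLattice b with hP
  have hcountP : Q.count b = P.ncard := rfl
  have hdimP : Q.latticeDim b = Module.finrank ℝ (vectorSpan ℝ P) := rfl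
  rw [hcountP] at hbad
  have hsep : ∀ x ∈ P, ∀ y ∈ P, x ≠ y → r ≤ ‖x - y‖ := fun x hx y hy hxy =>
    hgap _ ((frequencyGroup b).sub_mem hx.2 hy.2) (sub_ne_zero.2 hxy)
  have hPV : ∀ x ∈ P, ∀ y ∈ P, x - y ∈ vectorSpan ℝ P := fun x hx y hy =>
    vsub_mem_vectorSpan ℝ hx hy
  have hdiam : ∀ x ∈ P, ∀ y ∈ P, ‖x - y‖ ≤ n * K * R := fun x hx y hy =>
    hQ.norm_sub_le hK hR hδR hx.1 hy.1
  have hRn : R ^ (n - 1) = R ^ (n - 2) * R := by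
    rw [← pow_succ]; congr 1; omega
  -- a subspace of smaller dimension only has room for `O(R^{n-2})` lattice points
  have hge : n - 1 ≤ Module.finrank ℝ (vectorSpan ℝ P) := by
    by_contra! hlt
    have hle : Module.finrank ℝ (vectorSpan ℝ P) ≤ n - 2 := by omega
    have h1 := (ncard_le_of_sub_mem (vectorSpan ℝ P) P hr (by positivity) hsep hPV hdiam).2
    set d := Module.finrank ℝ (vectorSpan ℝ P)
    have h2 : (2 * ((d : ℝ) + 1) / r + 2) ^ d ≤ (2 * ((n : ℝ) + 1) / r + 2) ^ n := by
      have hdn : (d : ℝ) ≤ n := by exact_mod_cast (by omega : d ≤ n)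
      have h0 : 0 ≤ 2 * ((n : ℝ) + 1) / r := by positivity
      exact (pow_le_pow_left₀ (by positivity) (by gcongr) _).trans
        (pow_le_pow_right₀ (by linarith) (by omega))
    have h3 : (n * K * R + 1) ^ d ≤ (n * K + 1) ^ n * R ^ (n - 2) := by
      calc (n * K * R + 1) ^ d ≤ ((n * K + 1) * R) ^ d :=
            pow_le_pow_left₀ (by positivity) (by linarith) _
        _ = (n * K + 1) ^ d * R ^ d := mul_pow _ _ _
        _ ≤ _ := by
            gcongr
            · have : 0 ≤ n * K := by positivity
              linarith
            · omega
    have h4 : (P.ncard : ℝ) ≤ M₀ * R ^ (n - 2) := by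
      calc _ ≤ _ := h1
        _ ≤ (2 * ((n : ℝ) + 1) / r + 2) ^ n * ((n * K + 1) ^ n * R ^ (n - 2)) := by gcongr
        _ = _ := by rw [hM₀]; ring
    have h5 : c * R * R ^ (n - 2) ≤ q * M₀ * R ^ (n - 2) := by
      calc _ = c * R ^ (n - 1) := by rw [hRn]; ring
        _ ≤ _ := hbad
        _ ≤ q * (M₀ * R ^ (n - 2)) := by gcongr
        _ = _ := by ring
    have h6 := le_of_mul_le_mul_right h5 (by positivity)
    nlinarith
  have hrank : Module.finrank ℝ (vectorSpan ℝ P) = n - 1 := by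
    rcases hdim with h | h
    · rw [← hdimP, h]
    · by_contra hne
      have hfull : Module.finrank ℝ (vectorSpan ℝ P) = n := by
        have : Module.finrank ℝ (vectorSpan ℝ P) ≤ n := by
          simpa using Submodule.finrank_le (vectorSpan ℝ P)
        omega
      -- in full dimension, the volume `O(R^{n-1} δ)` of the cap bounds the number of points
      have htop : vectorSpan ℝ P = ⊤ :=
        Submodule.eq_top_of_finrank_eq (by rw [hfull]; simp)
      have h1 := hvol (frequencyGroup b) hgap Q (hQ.side_nonneg hK hδ hld) htop
      rw [coe_frequencyGroup, ← hP] at h1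
      have h2 := hQ.prod_side_le (by omega) hK hδ hld hR
      have h3 : c * R ^ (n - 1) ≤ c * (C * (q * δ)) * R ^ (n - 1) := by
        calc _ ≤ _ := hbad
          _ ≤ q * (C₁ * (K ^ n * R ^ (n - 1) * δ)) := by
              gcongr; exact h1.trans (by gcongr)
          _ = (C₁ * K ^ n) * (q * δ * R ^ (n - 1)) := by ring
          _ ≤ (c * C) * (q * δ * R ^ (n - 1)) := by gcongr
          _ = _ := by ring
      have h4 := le_of_mul_le_mul_right h3 (by positivity)
      nlinarith
  refine ⟨hdimP.trans hrank, ?_, ?_⟩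
  · intro ξ hξ w hw
    have h1 : C₂ * q ≤ R := (mul_le_mul_of_nonneg_right hCC₂ hq0.le).trans hCqR
    have h2 : ∀ x ∈ P, ∀ y ∈ P, |⟪ξ, x - y⟫_ℝ| ≤ ((n : ℝ) ^ 2 + 4) * K ^ 2 * R ^ 2 :=
      fun x hx y hy => hQ.abs_inner_chord_le hK hlam hδ hδ1 hR hδR hR2 hξ hx.1 hy.1
    have h3 := htube _ hrank P R q hR1 hq h1 hsep hPV hdiam hbad ξ h2 w hw
    refine h3.trans (mul_le_mul_of_nonneg_right ?_ (norm_nonneg w))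
    exact mul_le_mul_of_nonneg_right hCC₂ (by positivity)
  · have hnK : 1 ≤ n * K := by
      have : (1 : ℝ) ≤ n := by exact_mod_cast (by omega : 1 ≤ n)
      exact one_le_mul_of_one_le_of_one_le this hK
    have h1 : 1 ≤ C * q := one_le_mul_of_one_le_of_one_le hC1 hq
    have h2 : C * q ≤ n * K * R := hCqR.trans (le_mul_of_one_le_left hR0.le hnK)
    have h3 : C₃ * (n * K * R) ^ (n - 1) < P.ncard * (C * q) := by
      calc C₃ * (n * K * R) ^ (n - 1) = M₃ * R ^ (n - 1) := by rw [hM₃, mul_pow _ R]; ring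
        _ < c * C * R ^ (n - 1) := mul_lt_mul_of_pos_right hCM₃ (by positivity)
        _ = C * (c * R ^ (n - 1)) := by ring
        _ ≤ C * (q * P.ncard) := mul_le_mul_of_nonneg_left hbad hC0.le
        _ = _ := by ring
    have hspan := hshort _ hrank P (n * K * R) (C * q) h1 h2 hsep hPV hdiam h3
    obtain ⟨f, hf, hfs⟩ := exists_fin_span_eq hrank hspan
    refine ⟨f, fun i => ?_, hfs⟩
    obtain ⟨h1, x, hx, y, hy, hxy⟩ := hf i
    refine ⟨?_, h1⟩
    rw [← hxy]
    exact (frequencyGroup b).sub_mem hx.2 hy.2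

/-! ### Counting the bad caps -/

theorem exists_unit_normal {E : Type*} [NormedAddCommGroup E] [InnerProductSpace ℝ E]
    [FiniteDimensional ℝ E] {V : Submodule ℝ E}
    (hV : Module.finrank ℝ V + 1 = Module.finrank ℝ E) :
    ∃ ν : E, ‖ν‖ = 1 ∧ (∀ w ∈ V, ⟪ν, w⟫_ℝ = 0) ∧ ∀ x, x - ⟪ν, x⟫_ℝ • ν ∈ V := by
  have h1 : Module.finrank ℝ Vᗮ = 1 := by
    have := V.finrank_add_finrank_orthogonal
    omega
  let e := (stdOrthonormalBasis ℝ Vᗮ).reindex (finCongr h1)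
  refine ⟨e 0, e.norm_eq_one 0, fun w hw => ?_, fun x => ?_⟩
  · rw [real_inner_comm]; exact (V.mem_orthogonal _).1 (e 0).2 w hw
  · have hmem : x - ⟪((e 0 : Vᗮ) : E), x⟫_ℝ • ((e 0 : Vᗮ) : E) ∈ Vᗮᗮ := by
      rw [Submodule.mem_orthogonal]
      intro v hv
      have h2 := e.sum_repr ⟨v, hv⟩
      rw [Fin.sum_univ_one, e.repr_apply_apply] at h2
      have h3 : v = ⟪((e 0 : Vᗮ) : E), v⟫_ℝ • ((e 0 : Vᗮ) : E) := by
        simpa using (congrArg (Subtype.val) h2).symm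
      have h4 : ‖((e 0 : Vᗮ) : E)‖ = 1 := e.norm_eq_one 0
      rw [h3, inner_smul_left, inner_sub_right, inner_smul_right, real_inner_self_eq_norm_sq, h4]
      simp
    rwa [V.orthogonal_orthogonal] at hmem

theorem exists_orthonormalBasis_of_unit_normal {n : ℕ} {V : Submodule ℝ (Euc n)}
    (hV : Module.finrank ℝ V + 1 = n) :
    ∃ (e : OrthonormalBasis (Fin n) ℝ (Euc n)) (i₀ : Fin n), ∀ i ≠ i₀, e i ∈ V := by
  obtain ⟨ν, hν, -, hproj⟩ := exists_unit_normal (V := V) (by rw [hV]; simp)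
  obtain ⟨e, i₀, he⟩ := exists_orthonormalBasis_apply_eq (W := Euc n) (d := n) (by simp) hν
  refine ⟨e, i₀, fun i hi => ?_⟩
  have := hproj (e i)
  rwa [← he, e.inner_eq_zero hi.symm, zero_smul, sub_zero] at this

/-- Two unit vectors which are not antipodal and almost orthogonal to the same hyperplane are
close to each other. -/
theorem norm_sub_le_of_abs_inner_le {E : Type*} [NormedAddCommGroup E] [InnerProductSpace ℝ E]
    [FiniteDimensional ℝ E] {V : Submodule ℝ E}
    (hV : Module.finrank ℝ V + 1 = Module.finrank ℝ E) {u v : E} (hu : ‖u‖ = 1) (hv : ‖v‖ = 1)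
    (huv : ‖u - v‖ ≤ 1) {ε : ℝ} (hε0 : 0 ≤ ε) (hε : ε ≤ 1 / 2)
    (hwu : ∀ w ∈ V, |⟪w, u⟫_ℝ| ≤ ε * ‖w‖) (hwv : ∀ w ∈ V, |⟪w, v⟫_ℝ| ≤ ε * ‖w‖) :
    ‖u - v‖ ≤ 3 * ε := by
  obtain ⟨ν, hν, hperp, hproj⟩ := exists_unit_normal hV
  have hdec : ∀ x y : E, ⟪x, y⟫_ℝ = ⟪ν, x⟫_ℝ * ⟪ν, y⟫_ℝ +
      ⟪x - ⟪ν, x⟫_ℝ • ν, y - ⟪ν, y⟫_ℝ • ν⟫_ℝ := by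
    intro x y
    simp only [inner_sub_left, inner_sub_right, inner_smul_left, inner_smul_right,
      real_inner_self_eq_norm_sq, hν, RCLike.conj_to_real]
    rw [real_inner_comm ν x]; ring
  have key : ∀ x : E, (∀ w ∈ V, |⟪w, x⟫_ℝ| ≤ ε * ‖w‖) → ‖x - ⟪ν, x⟫_ℝ • ν‖ ≤ ε := by
    intro x hx
    have h1 : ⟪x - ⟪ν, x⟫_ℝ • ν, x⟫_ℝ = ‖x - ⟪ν, x⟫_ℝ • ν‖ ^ 2 := by
      have h3 := hperp _ (hproj x)
      rw [real_inner_comm] at h3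
      rw [← real_inner_self_eq_norm_sq, inner_sub_right _ x, inner_smul_right, h3]
      ring
    have h2 := hx _ (hproj x)
    rw [h1, abs_of_nonneg (sq_nonneg _), sq] at h2
    rcases (norm_nonneg (x - ⟪ν, x⟫_ℝ • ν)).eq_or_lt with h0 | h0
    · rwa [← h0]
    · exact le_of_mul_le_mul_right h2 h0
  have hpu := key u hwu
  have hpv := key v hwv
  have e1 := hdec u u
  have e2 := hdec v v
  have e3 := hdec u v
  rw [real_inner_self_eq_norm_sq, real_inner_self_eq_norm_sq, hu] at e1
  rw [real_inner_self_eq_norm_sq, real_inner_self_eq_norm_sq, hv] at e2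
  have e4 : 1 / 2 ≤ ⟪u, v⟫_ℝ := by
    have := norm_sub_sq_real u v
    rw [hu, hv] at this
    nlinarith [norm_nonneg (u - v)]
  have e5 := (abs_le.1 (abs_real_inner_le_norm (u - ⟪ν, u⟫_ℝ • ν) (v - ⟪ν, v⟫_ℝ • ν))).2
  set a := ⟪ν, u⟫_ℝ
  set c := ⟪ν, v⟫_ℝ
  have hsplit : u - v = ((u - a • ν) - (v - c • ν)) + (a - c) • ν := by
    rw [sub_smul]; abel
  have hle : ‖u - v‖ ≤ ‖u - a • ν‖ + ‖v - c • ν‖ + |a - c| := by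
    rw [hsplit]
    refine (norm_add_le _ _).trans ?_
    rw [norm_smul, hν, mul_one, Real.norm_eq_abs]
    gcongr
    exact norm_sub_le _ _
  set p := ‖u - a • ν‖
  set p' := ‖v - c • ν‖
  have hp0 : 0 ≤ p := norm_nonneg _
  have hp'0 : 0 ≤ p' := norm_nonneg _
  have hac : 1 / 4 ≤ a * c := by nlinarith [mul_le_mul hpu hpv hp'0 hε0]
  have hsum : 1 ≤ |a + c| := by
    rw [← one_le_sq_iff_one_le_abs]
    nlinarith [sq_nonneg (a - c)]
  have hprod : |a - c| * |a + c| ≤ ε := by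
    rw [← abs_mul]
    have h6 : (a - c) * (a + c) = p' ^ 2 - p ^ 2 := by nlinarith
    rw [h6, abs_le]
    constructor <;> nlinarith
  nlinarith [abs_nonneg (a - c)]

/-- Lattice points of a thin annulus which are orthogonal to a hyperplane `V` up to `O(R q)` lie
in two boxes, around the two points of the sphere normal to `V`, with `n - 1` sides `O(R q)` and
thickness `O(q²)`. -/
theorem exists_ncard_tube_le (n : ℕ) {r C₀ K : ℝ} (hr : 0 < r) (hC₀ : 0 ≤ C₀) (hK : 1 ≤ K) :
    ∃ C ≥ (1 : ℝ), ∀ (lam δ R q : ℝ), 1 ≤ lam → 0 < δ → δ ≤ 1 → R ^ 2 = lam * δ → 1 ≤ R → 1 ≤ q →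
      ∀ (V : Submodule ℝ (Euc n)), Module.finrank ℝ V + 1 = n → ∀ U : Set (Euc n),
      (∀ x ∈ U, ∀ y ∈ U, x ≠ y → r ≤ ‖x - y‖) →
      (∀ x ∈ U, |‖x‖ - lam| < K * δ) →
      (∀ x ∈ U, ∀ w ∈ V, |⟪w, x⟫_ℝ| ≤ C₀ * (R * q) * ‖w‖) →
      U.Finite ∧ (U.ncard : ℝ) ≤ C * (R ^ (n - 1) * q ^ (n + 1)) := by
  set M : ℝ := 3 * K ^ 2 + n * C₀ ^ 2 with hM
  have hM0 : 0 < M := by positivity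
  set B : ℝ := (2 * ((n : ℝ) + 1) / r + 2) ^ n with hB
  have hB1 : 1 ≤ B := by
    refine one_le_pow₀ ?_
    have : 0 ≤ 2 * ((n : ℝ) + 1) / r := by positivity
    linarith
  have hfac : 1 ≤ (2 * M + 1) * (2 * C₀ + 1) ^ (n - 1) :=
    one_le_mul_of_one_le_of_one_le (by linarith) (one_le_pow₀ (by linarith))
  refine ⟨2 * (B * ((2 * M + 1) * (2 * C₀ + 1) ^ (n - 1))), ?_, ?_⟩
  · have := one_le_mul_of_one_le_of_one_le hB1 hfac
    linarith
  intro lam δ R q hlam hδ hδ1 hR2 hR hq V hV U hsep hann htube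
  have hq0 : 0 < q := by linarith
  have hR0 : 0 < R := by linarith
  have hlam0 : 0 < lam := by linarith
  obtain ⟨e, i₀, he⟩ := exists_orthonormalBasis_of_unit_normal hV
  have hcoord : ∀ x ∈ U, ∀ i ≠ i₀, |⟪e i, x⟫_ℝ| ≤ C₀ * (R * q) := by
    intro x hx i hi
    have := htube x hx _ (he i hi)
    rwa [e.norm_eq_one, mul_one] at this
  have hα : ∀ x ∈ U, |(|⟪e i₀, x⟫_ℝ| - lam)| ≤ M * q ^ 2 := by
    intro x hx
    set a := |⟪e i₀, x⟫_ℝ| with ha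
    have ha0 : 0 ≤ a := abs_nonneg _
    have h1 : ‖x‖ ^ 2 = a ^ 2 + ∑ i ∈ Finset.univ.erase i₀, ⟪e i, x⟫_ℝ ^ 2 := by
      rw [← e.sum_sq_inner_right, ← Finset.add_sum_erase _ _ (Finset.mem_univ i₀), ha, sq_abs]
    have h2 : ∑ i ∈ Finset.univ.erase i₀, ⟪e i, x⟫_ℝ ^ 2 ≤ n * (C₀ * (R * q)) ^ 2 := by
      calc _ ≤ ∑ _i ∈ Finset.univ.erase i₀, (C₀ * (R * q)) ^ 2 := by
            refine Finset.sum_le_sum fun i hi => ?_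
            rw [← sq_abs]
            exact pow_le_pow_left₀ (abs_nonneg _) (hcoord x hx i (Finset.ne_of_mem_erase hi)) _
        _ ≤ ∑ _i : Fin n, (C₀ * (R * q)) ^ 2 :=
            Finset.sum_le_sum_of_subset_of_nonneg (Finset.erase_subset _ _)
              fun _ _ _ => sq_nonneg _
        _ = _ := by simp
    have h3 : 0 ≤ ∑ i ∈ Finset.univ.erase i₀, ⟪e i, x⟫_ℝ ^ 2 :=
      Finset.sum_nonneg fun _ _ => sq_nonneg _
    have h4 := abs_lt.1 (hann x hx)
    have hKδ : K * δ ≤ K * lam := by gcongr; linarith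
    have hKl : lam ≤ K * lam := le_mul_of_one_le_left hlam0.le hK
    have h5 : |‖x‖ ^ 2 - lam ^ 2| ≤ 3 * K ^ 2 * R ^ 2 := by
      have h6 : ‖x‖ ^ 2 - lam ^ 2 = (‖x‖ - lam) * (‖x‖ + lam) := by ring
      rw [h6, abs_mul, hR2, abs_of_nonneg (by positivity : 0 ≤ ‖x‖ + lam)]
      calc _ ≤ (K * δ) * (3 * (K * lam)) :=
            mul_le_mul (hann x hx).le (by linarith) (by positivity) (by positivity)
        _ = _ := by ring
    have hRq : R ^ 2 ≤ R ^ 2 * q ^ 2 := le_mul_of_one_le_right (by positivity) (one_le_pow₀ hq)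
    have h7 : |a ^ 2 - lam ^ 2| ≤ M * q ^ 2 * δ * lam := by
      have h8 : M * q ^ 2 * δ * lam = 3 * K ^ 2 * (R ^ 2 * q ^ 2) + n * (C₀ * (R * q)) ^ 2 := by
        rw [hM, mul_pow, mul_pow, hR2]; ring
      have h9 : 3 * K ^ 2 * R ^ 2 ≤ 3 * K ^ 2 * (R ^ 2 * q ^ 2) := by gcongr
      have h10 := abs_le.1 h5
      have h11 : 0 ≤ n * (C₀ * (R * q)) ^ 2 := by positivity
      have h12 : 0 ≤ 3 * K ^ 2 * R ^ 2 := by positivity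
      rw [h8, abs_le]
      constructor <;> linarith
    have h13 : |a - lam| * lam ≤ M * q ^ 2 * δ * lam := by
      refine le_trans ?_ h7
      have h14 : a ^ 2 - lam ^ 2 = (a - lam) * (a + lam) := by ring
      rw [h14, abs_mul, abs_of_nonneg (by positivity : 0 ≤ a + lam)]
      gcongr
      linarith
    refine (le_of_mul_le_mul_right h13 hlam0).trans ?_
    exact mul_le_of_le_one_right (by positivity) hδ1
  have half : ∀ T ⊆ U, (∀ x ∈ T, ∀ y ∈ T, |⟪e i₀, x⟫_ℝ - ⟪e i₀, y⟫_ℝ| ≤ 2 * M * q ^ 2) →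
      T.Finite ∧ (T.ncard : ℝ) ≤
        B * ((2 * M + 1) * (2 * C₀ + 1) ^ (n - 1)) * (R ^ (n - 1) * q ^ (n + 1)) := by
    intro T hTU hT
    obtain ⟨hfin, hcard⟩ := ncard_le_prod_of_width e T
      (fun i => if i = i₀ then 2 * M * q ^ 2 else 2 * (C₀ * (R * q)))
      (fun i => by split_ifs <;> positivity) hr
      (fun x hx y hy => hsep x (hTU hx) y (hTU hy))
      (fun x _ y _ => (e.sum_sq_inner_right _).ge)
      (fun x hx y hy i => by
        rw [inner_sub_right]
        split_ifs with hi
        · rw [hi]; exact hT x hx y hy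
        · have h1 := abs_le.1 (hcoord x (hTU hx) i hi)
          have h2 := abs_le.1 (hcoord y (hTU hy) i hi)
          rw [abs_le]; constructor <;> linarith)
    refine ⟨hfin, hcard.trans ?_⟩
    rw [prod_ite_width, Fintype.card_fin, ← hB]
    have h1 : 2 * M * q ^ 2 + 1 ≤ (2 * M + 1) * q ^ 2 := by
      have := one_le_pow₀ hq (n := 2)
      linarith
    have h2 : 2 * (C₀ * (R * q)) + 1 ≤ (2 * C₀ + 1) * (R * q) := by
      have := one_le_mul_of_one_le_of_one_le hR hq
      linarith
    calc _ ≤ B * (((2 * M + 1) * q ^ 2) * ((2 * C₀ + 1) * (R * q)) ^ (n - 1)) := by gcongr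
      _ = B * ((2 * M + 1) * (2 * C₀ + 1) ^ (n - 1)) * (R ^ (n - 1) * q ^ (n - 1 + 2)) := by
          rw [mul_pow, mul_pow, pow_add]; ring
      _ = _ := by rw [show n - 1 + 2 = n + 1 by omega]
  obtain ⟨hf1, hc1⟩ := half {x | x ∈ U ∧ 0 ≤ ⟪e i₀, x⟫_ℝ} (fun x hx => hx.1) (by
    rintro x ⟨hx, hx0⟩ y ⟨hy, hy0⟩
    have h1 := hα x hx
    have h2 := hα y hy
    rw [abs_of_nonneg hx0, abs_le] at h1
    rw [abs_of_nonneg hy0, abs_le] at h2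
    rw [abs_le]; constructor <;> linarith)
  obtain ⟨hf2, hc2⟩ := half {x | x ∈ U ∧ ⟪e i₀, x⟫_ℝ < 0} (fun x hx => hx.1) (by
    rintro x ⟨hx, hx0⟩ y ⟨hy, hy0⟩
    have h1 := hα x hx
    have h2 := hα y hy
    rw [abs_of_neg hx0, abs_le] at h1
    rw [abs_of_neg hy0, abs_le] at h2
    rw [abs_le]; constructor <;> linarith)
  have hU : U = {x | x ∈ U ∧ 0 ≤ ⟪e i₀, x⟫_ℝ} ∪ {x | x ∈ U ∧ ⟪e i₀, x⟫_ℝ < 0} := by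
    ext x
    constructor
    · intro hx
      rcases le_or_gt 0 ⟪e i₀, x⟫_ℝ with h | h
      · exact Or.inl ⟨hx, h⟩
      · exact Or.inr ⟨hx, h⟩
    · rintro (hx | hx) <;> exact hx.1
  refine ⟨hU ▸ hf1.union hf2, ?_⟩
  have hle : (U.ncard : ℝ) ≤ ({x | x ∈ U ∧ 0 ≤ ⟪e i₀, x⟫_ℝ}.ncard : ℝ) +
      ({x | x ∈ U ∧ ⟪e i₀, x⟫_ℝ < 0}.ncard : ℝ) := by
    have := Set.ncard_union_le {x | x ∈ U ∧ 0 ≤ ⟪e i₀, x⟫_ℝ} {x | x ∈ U ∧ ⟪e i₀, x⟫_ℝ < 0}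
    rw [← hU] at this
    exact_mod_cast this
  linarith

theorem sum_ncard_le_of_overlap {α ι : Type*} [Fintype ι] (s : Finset ι) (P : ι → Set α)
    {U : Set α} (hU : U.Finite) (hPU : ∀ i ∈ s, P i ⊆ U) {K : ℝ}
    (hoverlap : ∀ x, ({i | x ∈ P i}.ncard : ℝ) ≤ K) :
    ∑ i ∈ s, ((P i).ncard : ℝ) ≤ K * U.ncard := by
  classical
  have h1 : ∀ i ∈ s, (P i).ncard = (hU.toFinset.filter fun x => x ∈ P i).card := by
    intro i hi
    rw [← Set.ncard_coe_finset]
    congr 1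
    ext x
    simp only [Finset.coe_filter, Set.Finite.mem_toFinset, Set.mem_ofPred_eq]
    exact ⟨fun hx => ⟨hPU i hi hx, hx⟩, fun hx => hx.2⟩
  have h2 : ∀ x, ((s.filter fun i => x ∈ P i).card : ℝ) ≤ K := by
    intro x
    refine le_trans ?_ (hoverlap x)
    rw [← Set.ncard_coe_finset]
    exact_mod_cast Set.ncard_le_ncard (fun i hi => (Finset.mem_filter.1 hi).2) (Set.toFinite _)
  have h3 := Finset.sum_card_bipartiteAbove_eq_sum_card_bipartiteBelow (fun i x => x ∈ P i)
    (s := s) (t := hU.toFinset)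
  calc ∑ i ∈ s, ((P i).ncard : ℝ)
      = ((∑ i ∈ s, (hU.toFinset.filter fun x => x ∈ P i).card : ℕ) : ℝ) := by
        rw [Nat.cast_sum]; exact Finset.sum_congr rfl fun i hi => by rw [h1 i hi]
    _ = ((∑ x ∈ hU.toFinset, (s.filter fun i => x ∈ P i).card : ℕ) : ℝ) := by
        exact_mod_cast h3
    _ ≤ ∑ _x ∈ hU.toFinset, K := by
        rw [Nat.cast_sum]; exact Finset.sum_le_sum fun x _ => h2 x
    _ = _ := by rw [Finset.sum_const, nsmul_eq_mul, ← Set.ncard_eq_toFinset_card U hU, mul_comm]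

theorem exists_ncard_frequency_ball_le {n : ℕ} (b : Module.Basis (Fin n) ℝ (Euc n)) :
    ∃ B ≥ (1 : ℝ), ∀ ρ : ℝ, 1 ≤ ρ → {x | x ∈ frequencyLattice b ∧ ‖x‖ ≤ ρ}.Finite ∧
      ({x | x ∈ frequencyLattice b ∧ ‖x‖ ≤ ρ}.ncard : ℝ) ≤ B * ρ ^ n := by
  obtain ⟨r, hr, hgap⟩ := exists_frequency_gap b
  have h0 : 0 ≤ 2 * ((n : ℝ) + 1) / r := by positivity
  refine ⟨(2 * ((n : ℝ) + 1) / r + 2) ^ n * 3 ^ n,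
    one_le_mul_of_one_le_of_one_le (one_le_pow₀ (by linarith)) (one_le_pow₀ (by norm_num)), ?_⟩
  intro ρ hρ
  have h := ncard_le_of_sub_mem (⊤ : Submodule ℝ (Euc n))
    {x | x ∈ frequencyLattice b ∧ ‖x‖ ≤ ρ} hr (D := 2 * ρ) (by linarith)
    (fun x hx y hy hxy => hgap _ ((frequencyGroup b).sub_mem hx.1 hy.1) (sub_ne_zero.2 hxy))
    (fun _ _ _ _ => Submodule.mem_top)
    (fun x hx y hy => (norm_sub_le x y).trans (by have := hx.2; have := hy.2; linarith))
  have hrank : Module.finrank ℝ (⊤ : Submodule ℝ (Euc n)) = n := by simp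
  rw [hrank] at h
  refine ⟨h.1, h.2.trans ?_⟩
  rw [mul_assoc, ← mul_pow 3]
  gcongr
  linarith

/-- Bad caps are classified by a short basis of the hyperplane of their lattice points. There are
`O(q^{n(n-1)})` such bases. As the caps with the same hyperplane overlap boundedly, and as their
lattice points lie in a common tube, there are `O(q^{n+2})` of them. -/
theorem exists_card_badCaps_le (n : ℕ) (hn : 2 ≤ n) (b : Module.Basis (Fin n) ℝ (Euc n))
    {K c C₀ : ℝ} (hK : 1 ≤ K) (hc : 0 < c) (hC₀ : 1 ≤ C₀) :
    ∃ C ≥ (1 : ℝ), ∀ (lam δ R q : ℝ), 1 ≤ lam → 0 < δ → δ ≤ 1 → R ^ 2 = lam * δ → 1 ≤ R → 1 ≤ q →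
      ∀ (ι : Type) [Fintype ι] (Ω : ι → Box n), (∀ i, (Ω i).IsCap K lam δ) →
      (∀ ξ, ({i | ξ ∈ (Ω i).points}.ncard : ℝ) ≤ K) → ∀ s : Finset ι,
      (∀ i ∈ s, c * R ^ (n - 1) ≤ q * (Ω i).count b) →
      (∀ i ∈ s, (Ω i).latticeDim b = n - 1) →
      (∀ i ∈ s, ∀ ξ ∈ (Ω i).points,
        ∀ w ∈ vectorSpan ℝ ((Ω i).points ∩ frequencyLattice b),
        |⟪w, ξ⟫_ℝ| ≤ C₀ * (R * q) * ‖w‖) →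
      (∀ i ∈ s, ∃ f : Fin (n - 1) → Euc n, (∀ j, f j ∈ frequencyLattice b ∧ ‖f j‖ ≤ C₀ * q) ∧
          Submodule.span ℝ (Set.range f) =
            vectorSpan ℝ ((Ω i).points ∩ frequencyLattice b)) →
      (s.card : ℝ) ≤ C * q ^ (n * n + 2) := by
  classical
  obtain ⟨r, hr, hgap⟩ := exists_frequency_gap b
  obtain ⟨B, hB, hball⟩ := exists_ncard_frequency_ball_le b
  obtain ⟨C₁, hC₁, htubecount⟩ := exists_ncard_tube_le n hr (by linarith : 0 ≤ C₀) hK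
  have hB0 : 0 < B := by linarith
  set D : ℝ := (B * C₀ ^ n) ^ (n - 1) * (K * C₁ / c) + 1 with hD
  have hD0 : 0 ≤ (B * C₀ ^ n) ^ (n - 1) * (K * C₁ / c) := by positivity
  refine ⟨D, by linarith, ?_⟩
  intro lam δ R q hlam hδ hδ1 hR2 hR hq ι _ Ω hcap hoverlap s hbad hdim htube hshort
  have hq0 : 0 < q := by linarith
  have hR0 : 0 < R := by linarith
  obtain ⟨hGfin, hGcard⟩ := hball (C₀ * q) (one_le_mul_of_one_le_of_one_le hC₀ hq)
  have hf : ∀ i, ∃ f : Fin (n - 1) → Euc n, i ∈ s →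
      (∀ j, f j ∈ frequencyLattice b ∧ ‖f j‖ ≤ C₀ * q) ∧
          Submodule.span ℝ (Set.range f) =
            vectorSpan ℝ ((Ω i).points ∩ frequencyLattice b) := by
    intro i
    by_cases hi : i ∈ s
    · obtain ⟨f, hf⟩ := hshort i hi; exact ⟨f, fun _ => hf⟩
    · exact ⟨0, fun h => absurd h hi⟩
  choose f hf using hf
  set J : Finset (Fin (n - 1) → Euc n) := Fintype.piFinset fun _ => hGfin.toFinset with hJ
  have hJcard : (J.card : ℝ) ≤ (B * C₀ ^ n) ^ (n - 1) * q ^ (n * (n - 1)) := by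
    rw [hJ, Fintype.card_piFinset_const, ← Set.ncard_eq_toFinset_card _ hGfin,
      Nat.cast_pow]
    calc _ ≤ (B * (C₀ * q) ^ n) ^ (n - 1) := by gcongr
      _ = _ := by rw [mul_pow C₀, ← mul_assoc, mul_pow _ (q ^ n), pow_mul]
  have hfiber : ∀ j ∈ J, (((s.filter fun i => f i = j).card : ℕ) : ℝ) ≤
      (K * C₁ / c) * q ^ (n + 2) := by
    intro j _
    rcases (s.filter fun i => f i = j).eq_empty_or_nonempty with h0 | ⟨i₁, hi₁⟩
    · rw [h0]; simp only [Finset.card_empty, Nat.cast_zero]; positivity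
    rw [Finset.mem_filter] at hi₁
    set V : Submodule ℝ (Euc n) := Submodule.span ℝ (Set.range j) with hV
    have hVi : ∀ i ∈ s.filter (fun i => f i = j),
        vectorSpan ℝ ((Ω i).points ∩ frequencyLattice b) = V := by
      intro i hi
      rw [Finset.mem_filter] at hi
      rw [hV, ← hi.2, (hf i hi.1).2]
    have hVrank : Module.finrank ℝ V + 1 = n := by
      have h1 : Module.finrank ℝ V = n - 1 := by
        rw [← hVi i₁ (Finset.mem_filter.2 hi₁)]; exact hdim i₁ hi₁.1
      omega
    obtain ⟨hUfin, hUcard⟩ := htubecount lam δ R q hlam hδ hδ1 hR2 hR hq V hVrank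
      {x | x ∈ frequencyLattice b ∧ |‖x‖ - lam| < K * δ ∧
        ∀ w ∈ V, |⟪w, x⟫_ℝ| ≤ C₀ * (R * q) * ‖w‖}
      (fun x hx y hy hxy => hgap _ ((frequencyGroup b).sub_mem hx.1 hy.1) (sub_ne_zero.2 hxy))
      (fun x hx => hx.2.1) (fun x hx => hx.2.2)
    set U : Set (Euc n) := {x | x ∈ frequencyLattice b ∧ |‖x‖ - lam| < K * δ ∧
        ∀ w ∈ V, |⟪w, x⟫_ℝ| ≤ C₀ * (R * q) * ‖w‖} with hU
    have hsum := sum_ncard_le_of_overlap (s.filter fun i => f i = j)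
      (fun i => (Ω i).points ∩ frequencyLattice b) hUfin (K := K)
      (fun i hi x hx => ⟨hx.2, (hcap i).near_sphere hx.1, fun w hw =>
        htube i (Finset.mem_filter.1 hi).1 x hx.1 w (by rwa [hVi i hi])⟩)
      (fun x => le_trans (Nat.cast_le.2 (Set.ncard_le_ncard
        (t := {i | x ∈ (Ω i).points}) (fun i hi => hi.1) (Set.toFinite _))) (hoverlap x))
    set t := (s.filter fun i => f i = j) with ht
    have h1 : (t.card : ℝ) * (c * R ^ (n - 1)) ≤ q * (K * U.ncard) := by
      calc (t.card : ℝ) * (c * R ^ (n - 1)) = ∑ _i ∈ t, c * R ^ (n - 1) := by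
            rw [Finset.sum_const, nsmul_eq_mul]
        _ ≤ ∑ i ∈ t, q * ((Ω i).count b : ℝ) :=
            Finset.sum_le_sum fun i hi => hbad i (Finset.mem_filter.1 hi).1
        _ = q * ∑ i ∈ t, ((Ω i).count b : ℝ) := by rw [Finset.mul_sum]
        _ ≤ _ := mul_le_mul_of_nonneg_left hsum hq0.le
    have h2 : (t.card : ℝ) * c * R ^ (n - 1) ≤ K * C₁ * q ^ (n + 2) * R ^ (n - 1) := by
      calc _ = (t.card : ℝ) * (c * R ^ (n - 1)) := by ring
        _ ≤ _ := h1
        _ ≤ q * (K * (C₁ * (R ^ (n - 1) * q ^ (n + 1)))) := by gcongr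
        _ = _ := by ring
    have h3 := le_of_mul_le_mul_right h2 (by positivity)
    calc (t.card : ℝ) ≤ K * C₁ * q ^ (n + 2) / c := by rwa [le_div_iff₀ hc]
      _ = _ := by ring
  have hmaps : Set.MapsTo f s J := by
    intro i hi
    rw [hJ, Finset.mem_coe, Fintype.mem_piFinset]
    intro j
    rw [Set.Finite.mem_toFinset]
    exact (hf i hi).1 j
  rw [Finset.card_eq_sum_card_fiberwise hmaps, Nat.cast_sum]
  calc _ ≤ J.card • ((K * C₁ / c) * q ^ (n + 2)) := Finset.sum_le_card_nsmul _ _ _ hfiber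
    _ = (J.card : ℝ) * ((K * C₁ / c) * q ^ (n + 2)) := nsmul_eq_mul _ _
    _ ≤ ((B * C₀ ^ n) ^ (n - 1) * q ^ (n * (n - 1))) * ((K * C₁ / c) * q ^ (n + 2)) := by gcongr
    _ = ((B * C₀ ^ n) ^ (n - 1) * (K * C₁ / c)) * q ^ (n * (n - 1) + (n + 2)) := by
        rw [pow_add]; ring
    _ = ((B * C₀ ^ n) ^ (n - 1) * (K * C₁ / c)) * q ^ (n * n + 2) := by
        congr 2
        obtain ⟨m, rfl⟩ : ∃ m, n = m + 1 := ⟨n - 1, by omega⟩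
        simp only [Nat.add_sub_cancel]; ring
    _ ≤ _ := by gcongr; linarith

/-! ### Counting the frequencies in bad caps -/

/-- The frequencies in a sector which lie in a cap with at least `c R^{n-1} / q` lattice points. -/
def badFrequencies {n : ℕ} {ι : Type} (b : Module.Basis (Fin n) ℝ (Euc n)) (c R q lam δ : ℝ)
    (Ω : ι → Box n) (Γ : Set (Euc n)) : Set (Euc n) :=
  {ξ | ξ ∈ frequencyLattice b ∧ ξ ∈ sector lam δ Γ ∧
    ∃ i, c * R ^ (n - 1) ≤ q * (Ω i).count b ∧ ξ ∈ (Ω i).points}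

theorem ncard_le_card_mul {α κ : Type*} {S : Set α} (t : Finset κ) (P : κ → Set α)
    (hfin : ∀ i ∈ t, (P i).Finite) (hS : S ⊆ ⋃ i ∈ t, P i) {M : ℝ}
    (hM : ∀ i ∈ t, ((P i).ncard : ℝ) ≤ M) : S.Finite ∧ (S.ncard : ℝ) ≤ t.card * M := by
  have h1 : (⋃ i ∈ t, P i).Finite := Set.Finite.biUnion t.finite_toSet hfin
  refine ⟨h1.subset hS, ?_⟩
  calc (S.ncard : ℝ) ≤ ((⋃ i ∈ t, P i).ncard : ℝ) := by exact_mod_cast Set.ncard_le_ncard hS h1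
    _ ≤ ((∑ i ∈ t, (P i).ncard : ℕ) : ℝ) := by exact_mod_cast t.set_ncard_biUnion_le P
    _ ≤ _ := by
      rw [Nat.cast_sum, ← nsmul_eq_mul]; exact Finset.sum_le_card_nsmul _ _ _ hM

theorem norm_sub_le_one_of_mem_polarDirections {n : ℕ} {u v : Euc n}
    (hu : u ∈ polarDirections n) (hv : v ∈ polarDirections n) : ‖u - v‖ ≤ 1 := by
  have h1 : u - v = (u - northPole n) - (v - northPole n) := by abel
  have h2 : ‖u - northPole n‖ ≤ 1 / 2 := hu.2
  have h3 : ‖v - northPole n‖ ≤ 1 / 2 := hv.2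
  rw [h1]
  exact (norm_sub_le _ _).trans (by linarith)

/-- Frequencies in separated sectors cannot both be almost orthogonal to the same hyperplane, as
the separation `s δ lam` is large compared with the width `R q` of the tube. -/
theorem not_both_mem_tube {n : ℕ} {V : Submodule ℝ (Euc n)} (hV : Module.finrank ℝ V + 1 = n)
    {C₀ s lam δ R q : ℝ} (hC₀ : 1 ≤ C₀) (hlam : 1 ≤ lam) (hδ1 : δ ≤ 1)
    (hR2 : R ^ 2 = lam * δ) (hq : 1 ≤ q) (hR4 : 4 * C₀ * q ≤ R) (hRs : 12 * C₀ * q < s * R)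
    {Γ Γ' : Set (Euc n)} (hΓ : Γ ⊆ polarDirections n) (hΓ' : Γ' ⊆ polarDirections n)
    (hsep : ∀ u ∈ Γ, ∀ u' ∈ Γ', s * δ ≤ ‖u - u'‖) {ξ ζ : Euc n}
    (hξ : ξ ∈ sector lam δ Γ) (hζ : ζ ∈ sector lam δ Γ')
    (hξV : ∀ w ∈ V, |⟪w, ξ⟫_ℝ| ≤ C₀ * (R * q) * ‖w‖)
    (hζV : ∀ w ∈ V, |⟪w, ζ⟫_ℝ| ≤ C₀ * (R * q) * ‖w‖) : False := by
  have hlam0 : 0 < lam := by linarith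
  have hCq : 1 ≤ C₀ * q := one_le_mul_of_one_le_of_one_le hC₀ hq
  have hR1 : 4 ≤ R := by linarith
  have hRlam : R ^ 2 ≤ lam := by rw [hR2]; exact mul_le_of_le_one_right hlam0.le hδ1
  have hlam2 : 2 ≤ lam := by nlinarith
  set ε : ℝ := 2 * C₀ * (R * q) / lam with hε
  have hε0 : 0 ≤ ε := by positivity
  have hε2 : ε ≤ 1 / 2 := by
    rw [hε, div_le_iff₀ hlam0]
    nlinarith
  have key : ∀ (Δ : Set (Euc n)) (x : Euc n), x ∈ sector lam δ Δ →
      (∀ w ∈ V, |⟪w, x⟫_ℝ| ≤ C₀ * (R * q) * ‖w‖) →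
      ∀ w ∈ V, |⟪w, ‖x‖⁻¹ • x⟫_ℝ| ≤ ε * ‖w‖ := by
    intro Δ x hx hxV w hw
    have hann : |‖x‖ - lam| < δ := hx.1
    have hx2 : lam / 2 ≤ ‖x‖ := by have := (abs_lt.1 hann).1; linarith
    have hx0 : 0 < ‖x‖ := by linarith
    rw [inner_smul_right, abs_mul, abs_of_pos (inv_pos.2 hx0), inv_mul_le_iff₀ hx0]
    calc _ ≤ _ := hxV w hw
      _ = lam / 2 * (ε * ‖w‖) := by rw [hε]; field_simp
      _ ≤ _ := by gcongr
  have hu := hΓ hξ.2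
  have hv := hΓ' hζ.2
  have h1 := norm_sub_le_of_abs_inner_le (V := V) (by rw [hV]; simp) hu.1 hv.1
    (norm_sub_le_one_of_mem_polarDirections hu hv) hε0 hε2 (key Γ ξ hξ hξV) (key Γ' ζ hζ hζV)
  have h2 := (hsep _ hξ.2 _ hζ.2).trans h1
  have h3 : s * R * R ≤ 6 * C₀ * q * R := by
    calc s * R * R = s * δ * lam := by rw [mul_assoc, ← sq, hR2]; ring
      _ ≤ 3 * ε * lam := by gcongr
      _ = _ := by rw [hε]; field_simp; ring
  have h4 := le_of_mul_le_mul_right h3 (by linarith)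
  linarith

/-- Counts for all bad caps together. A representation `m = ξ + ζ` puts `ξ` in a cap with hyperplane
`V` and `ζ` in one with a different hyperplane `V'`, so that for each pair of caps `ξ` ranges over a
coset of the `(n - 2)`-dimensional space `V ⊓ V'`. -/
theorem exists_ncard_badFrequencies_le (n : ℕ) (hn : 2 ≤ n)
    (b : Module.Basis (Fin n) ℝ (Euc n)) {K c s : ℝ} (hK : 1 ≤ K) (hc : 0 < c) (hs : 0 < s) :
    ∃ C ≥ (1 : ℝ), ∀ (lam δ R q : ℝ), 1 ≤ lam → 0 < δ → δ ≤ 1 → 1 ≤ lam * δ →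
      R = (lam * δ) ^ (1 / 2 : ℝ) → 1 ≤ q → C * q ≤ R →
      ∀ (ι : Type) [Fintype ι] (Ω : ι → Box n), (∀ i, (Ω i).IsCap K lam δ) →
      (∀ ξ, ({i | ξ ∈ (Ω i).points}.ncard : ℝ) ≤ K) →
      (C * (q * δ) < 1 ∨ ∀ i, c * R ^ (n - 1) ≤ q * (Ω i).count b →
        (Ω i).latticeDim b = n - 1) →
      ∀ Γ Γ' : Set (Euc n), Γ ⊆ polarDirections n → Γ' ⊆ polarDirections n →
      (∀ u ∈ Γ, ∀ u' ∈ Γ', s * δ ≤ ‖u - u'‖) →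
      ((badFrequencies b c R q lam δ Ω Γ).ncard : ℝ) ≤ C * (q ^ (n * n + 2) * R ^ (n - 1)) ∧
      ((badFrequencies b c R q lam δ Ω Γ').ncard : ℝ) ≤ C * (q ^ (n * n + 2) * R ^ (n - 1)) ∧
      ∀ m, ({ξ | ξ ∈ badFrequencies b c R q lam δ Ω Γ ∧
          m - ξ ∈ badFrequencies b c R q lam δ Ω Γ'}.ncard : ℝ) ≤
        C * (q ^ (2 * (n * n + 2)) * R ^ (n - 2)) := by
  classical
  obtain ⟨r, hr, hgap⟩ := exists_frequency_gap b
  obtain ⟨C₀, hC₀, hstruct⟩ := exists_badCap_structure n hn b hK hc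
  obtain ⟨C₁, hC₁, hcaps⟩ := exists_card_badCaps_le n hn b hK hc hC₀
  set B : ℝ := (2 * ((n : ℝ) + 1) / r + 2) ^ n * (n * K + 1) ^ n with hB
  have hr0 : 0 ≤ 2 * ((n : ℝ) + 1) / r := by positivity
  have hB1 : 1 ≤ B := by
    refine one_le_mul_of_one_le_of_one_le (one_le_pow₀ (by linarith)) (one_le_pow₀ ?_)
    have : 0 ≤ n * K := by positivity
    linarith
  have hB0 : 0 < B := by linarith
  set C : ℝ := 4 * C₀ + 12 * C₀ / s + 1 + C₁ ^ 2 * B with hC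
  have hs0 : 0 < 12 * C₀ / s := by positivity
  have hCB : 0 < C₁ ^ 2 * B := by positivity
  have hC1 : 1 ≤ C := by linarith
  have hCC : C₁ ^ 2 * B ≤ C := by linarith
  have hC4 : 4 * C₀ ≤ C := by linarith
  have hCs : 12 * C₀ < s * C := by
    have : s * (12 * C₀ / s) = 12 * C₀ := by field_simp
    nlinarith
  clear_value C B
  refine ⟨C, hC1, ?_⟩
  intro lam δ R q hlam hδ hδ1 hld hR hq hCqR ι _ Ω hcap hoverlap hdim Γ Γ' hΓ hΓ' hsep
  obtain ⟨hR2, hR1, hδR⟩ := one_le_and_le_of_eq_rpow_half hδ1 hld hR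
  have hq0 : 0 < q := by linarith
  have hR0 : 0 < R := by linarith
  have hC₀C : C₀ ≤ C := by linarith
  have hC₀q : C₀ * q ≤ R := (mul_le_mul_of_nonneg_right hC₀C hq0.le).trans hCqR
  set t : Finset ι := Finset.univ.filter fun i => c * R ^ (n - 1) ≤ q * (Ω i).count b with ht
  have hmemt : ∀ i, i ∈ t ↔ c * R ^ (n - 1) ≤ q * (Ω i).count b := by simp [ht]
  have hst : ∀ i ∈ t, _ := fun i hi => hstruct lam δ R q hlam hδ hδ1 hld hR hq hC₀q (Ω i) (hcap i)
    ((hmemt i).1 hi) (by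
      rcases hdim with h | h
      · refine Or.inr (lt_of_le_of_lt ?_ h)
        exact mul_le_mul_of_nonneg_right hC₀C (by positivity)
      · exact Or.inl (h i ((hmemt i).1 hi)))
  have htcard := hcaps lam δ R q hlam hδ hδ1 hR2 hR1 hq ι Ω hcap hoverlap t
    (fun i hi => (hmemt i).1 hi) (fun i hi => (hst i hi).1) (fun i hi => (hst i hi).2.1)
    (fun i hi => (hst i hi).2.2)
  -- points of one cap whose differences lie in a given subspace
  have hpts : ∀ (W : Submodule ℝ (Euc n)) (d : ℕ), Module.finrank ℝ W ≤ d → d ≤ n → ∀ i,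
      ∀ T ⊆ (Ω i).points ∩ frequencyLattice b, (∀ x ∈ T, ∀ y ∈ T, x - y ∈ W) →
      T.Finite ∧ (T.ncard : ℝ) ≤ B * R ^ d := by
    intro W d hWd hdn i T hT hTW
    have h1 := ncard_le_of_sub_mem W T hr (by positivity : 0 ≤ n * K * R)
      (fun x hx y hy hxy => hgap _ ((frequencyGroup b).sub_mem (hT hx).2 (hT hy).2)
        (sub_ne_zero.2 hxy)) hTW
      (fun x hx y hy => (hcap i).norm_sub_le hK hR hδR (hT hx).1 (hT hy).1)
    refine ⟨h1.1, h1.2.trans ?_⟩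
    set e := Module.finrank ℝ W
    have hnK : 0 ≤ n * K := by positivity
    have h2 : (2 * ((e : ℝ) + 1) / r + 2) ^ e ≤ (2 * ((n : ℝ) + 1) / r + 2) ^ n := by
      have hen : (e : ℝ) ≤ n := by exact_mod_cast hWd.trans hdn
      exact (pow_le_pow_left₀ (by positivity) (by gcongr) _).trans
        (pow_le_pow_right₀ (by linarith) (hWd.trans hdn))
    have h3 : (n * K * R + 1) ^ e ≤ (n * K + 1) ^ n * R ^ d := by
      calc (n * K * R + 1) ^ e ≤ ((n * K + 1) * R) ^ e :=
            pow_le_pow_left₀ (by positivity) (by linarith) _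
        _ = (n * K + 1) ^ e * R ^ e := mul_pow _ _ _
        _ ≤ _ := mul_le_mul (pow_le_pow_right₀ (by linarith) (hWd.trans hdn))
            (pow_le_pow_right₀ hR1 hWd) (by positivity) (by positivity)
    calc _ ≤ (2 * ((n : ℝ) + 1) / r + 2) ^ n * ((n * K + 1) ^ n * R ^ d) := by gcongr
      _ = _ := by rw [hB]; ring
  have hsingle : ∀ Δ : Set (Euc n),
      ((badFrequencies b c R q lam δ Ω Δ).ncard : ℝ) ≤ C * (q ^ (n * n + 2) * R ^ (n - 1)) := by
    intro Δ
    have h1 := (ncard_le_card_mul (S := badFrequencies b c R q lam δ Ω Δ) t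
      (fun i => (Ω i).points ∩ frequencyLattice b) (M := B * R ^ (n - 1))
      (fun i hi => (hpts _ (n - 1) (hst i hi).1.le (by omega) i _ subset_rfl
        (fun x hx y hy => vsub_mem_vectorSpan ℝ hx hy)).1)
      (by
        rintro ξ ⟨hξ, -, i, hi, hξi⟩
        exact Set.mem_biUnion ((hmemt i).2 hi) ⟨hξi, hξ⟩)
      (fun i hi => (hpts _ (n - 1) (hst i hi).1.le (by omega) i _ subset_rfl
        (fun x hx y hy => vsub_mem_vectorSpan ℝ hx hy)).2)).2
    have hC₁2 : C₁ ≤ C₁ ^ 2 := le_self_pow₀ hC₁ (by norm_num)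
    calc _ ≤ _ := h1
      _ ≤ (C₁ * q ^ (n * n + 2)) * (B * R ^ (n - 1)) := by gcongr
      _ = C₁ * B * (q ^ (n * n + 2) * R ^ (n - 1)) := by ring
      _ ≤ C₁ ^ 2 * B * (q ^ (n * n + 2) * R ^ (n - 1)) := by gcongr
      _ ≤ _ := by gcongr
  refine ⟨hsingle Γ, hsingle Γ', fun m => ?_⟩
  let V : ι → Submodule ℝ (Euc n) := fun i => vectorSpan ℝ ((Ω i).points ∩ frequencyLattice b)
  -- the hyperplanes of two caps that meet the two sectors are different
  set t₂ : Finset (ι × ι) := (t ×ˢ t).filter fun p => V p.1 ≠ V p.2 with ht₂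
  have hmem₂ : ∀ p ∈ t₂, p.1 ∈ t ∧ p.2 ∈ t ∧ V p.1 ≠ V p.2 := by
    intro p hp
    rw [ht₂, Finset.mem_filter, Finset.mem_product] at hp
    exact ⟨hp.1.1, hp.1.2, hp.2⟩
  have hboth : ∀ p ∈ t₂, ({ξ | ξ ∈ (Ω p.1).points ∩ frequencyLattice b ∧
      m - ξ ∈ (Ω p.2).points ∩ frequencyLattice b} : Set (Euc n)).Finite ∧
      (({ξ | ξ ∈ (Ω p.1).points ∩ frequencyLattice b ∧
      m - ξ ∈ (Ω p.2).points ∩ frequencyLattice b} : Set (Euc n)).ncard : ℝ) ≤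
      B * R ^ (n - 2) := by
    intro p hp
    obtain ⟨hp1, hp2, hne⟩ := hmem₂ p hp
    have hr1 : Module.finrank ℝ (V p.1) = n - 1 := (hst _ hp1).1
    have hr2 : Module.finrank ℝ (V p.2) = n - 1 := (hst _ hp2).1
    have hlt : V p.1 ⊓ V p.2 < V p.1 := by
      refine lt_of_le_of_ne inf_le_left fun heq => hne ?_
      exact Submodule.eq_of_le_of_finrank_eq (inf_eq_left.1 heq) (hr1.trans hr2.symm)
    have hrank : Module.finrank ℝ (V p.1 ⊓ V p.2 : Submodule ℝ (Euc n)) ≤ n - 2 := by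
      have := Submodule.finrank_lt_finrank_of_lt hlt
      omega
    refine hpts (V p.1 ⊓ V p.2) (n - 2) hrank (by omega) p.1 _ (fun x hx => hx.1) ?_
    intro x hx y hy
    refine ⟨vsub_mem_vectorSpan ℝ hx.1 hy.1, ?_⟩
    have h1 : x - y = (m - y) - (m - x) := by abel
    rw [h1]
    exact vsub_mem_vectorSpan ℝ hy.2 hx.2
  have h1 := (ncard_le_card_mul (S := {ξ | ξ ∈ badFrequencies b c R q lam δ Ω Γ ∧
          m - ξ ∈ badFrequencies b c R q lam δ Ω Γ'}) t₂ _ (fun p hp => (hboth p hp).1)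
    (by
      rintro ξ ⟨⟨hξ, hξΓ, i, hi, hξi⟩, ⟨hζ, hζΓ, j, hj, hζj⟩⟩
      have hit := (hmemt i).2 hi
      have hjt := (hmemt j).2 hj
      refine Set.mem_biUnion (x := (i, j)) ?_ ⟨⟨hξi, hξ⟩, ⟨hζj, hζ⟩⟩
      rw [Finset.mem_coe, ht₂, Finset.mem_filter, Finset.mem_product]
      refine ⟨⟨hit, hjt⟩, fun heq => ?_⟩
      have hrank : Module.finrank ℝ (V i) + 1 = n := by
        have : Module.finrank ℝ (V i) = n - 1 := (hst i hit).1
        omega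
      refine not_both_mem_tube hrank hC₀ hlam hδ1 hR2 hq
        ((mul_le_mul_of_nonneg_right hC4 hq0.le).trans hCqR) ?_ hΓ hΓ' hsep hξΓ hζΓ
        (fun w hw => (hst i hit).2.1 _ hξi w hw)
        (fun w hw => (hst j hjt).2.1 _ hζj w ?_)
      · calc 12 * C₀ * q < s * C * q := mul_lt_mul_of_pos_right hCs hq0
          _ = s * (C * q) := by ring
          _ ≤ s * R := by gcongr
      · change V i = V j at heq
        rw [heq] at hw
        exact hw)
    (fun p hp => (hboth p hp).2)).2
  have h2 : (t₂.card : ℝ) ≤ (C₁ * q ^ (n * n + 2)) * (C₁ * q ^ (n * n + 2)) := by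
    calc (t₂.card : ℝ) ≤ ((t ×ˢ t).card : ℝ) := by exact_mod_cast Finset.card_filter_le _ _
      _ = (t.card : ℝ) * t.card := by rw [Finset.card_product]; push_cast; ring
      _ ≤ _ := by gcongr
  calc _ ≤ _ := h1
    _ ≤ (C₁ * q ^ (n * n + 2)) * (C₁ * q ^ (n * n + 2)) * (B * R ^ (n - 2)) := by gcongr
    _ = C₁ ^ 2 * B * (q ^ (2 * (n * n + 2)) * R ^ (n - 2)) := by rw [two_mul, pow_add]; ring
    _ ≤ _ := by gcongr

/-! ### Trigonometric polynomials on the torus -/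

/-- The absolute value of the normalized exponentials of the torus. -/
noncomputable def expScale {n : ℕ} (b : Module.Basis (Fin n) ℝ (Euc n)) : ℝ :=
  (torusMeasure b).real Set.univ ^ (-(1 / 2) : ℝ)

theorem isFiniteMeasure_torusMeasure {n : ℕ} (b : Module.Basis (Fin n) ℝ (Euc n)) :
    IsFiniteMeasure (torusMeasure b) :=
  ⟨by
    rw [torusMeasure, Measure.restrict_apply_univ]
    exact (ZSpan.fundamentalDomain_isBounded b).measure_lt_top⟩

theorem torusMeasure_real_univ_pos {n : ℕ} (b : Module.Basis (Fin n) ℝ (Euc n)) :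
    0 < (torusMeasure b).real Set.univ := by
  have := isFiniteMeasure_torusMeasure b
  rw [Measure.real, ENNReal.toReal_pos_iff]
  refine ⟨pos_iff_ne_zero.2 ?_, measure_lt_top _ _⟩
  rw [torusMeasure, Measure.restrict_apply_univ]
  exact ZSpan.measure_fundamentalDomain_ne_zero b

theorem expScale_pos {n : ℕ} (b : Module.Basis (Fin n) ℝ (Euc n)) : 0 < expScale b :=
  Real.rpow_pos_of_pos (torusMeasure_real_univ_pos b) _

theorem expScale_sq_mul {n : ℕ} (b : Module.Basis (Fin n) ℝ (Euc n)) :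
    expScale b ^ 2 * (torusMeasure b).real Set.univ = 1 := by
  have h := torusMeasure_real_univ_pos b
  rw [expScale, ← Real.rpow_natCast, ← Real.rpow_mul h.le]
  norm_num
  rw [Real.rpow_neg_one, inv_mul_cancel₀ h.ne']

theorem torusExp_eq {n : ℕ} (b : Module.Basis (Fin n) ℝ (Euc n)) (k x : Euc n) :
    torusExp b k x =
      (expScale b : ℂ) * Complex.exp (((2 * Real.pi * ⟪k, x⟫_ℝ : ℝ) : ℂ) * Complex.I) := by
  rw [torusExp, expScale]
  congr 2
  push_cast; ring

theorem norm_torusExp {n : ℕ} (b : Module.Basis (Fin n) ℝ (Euc n)) (k x : Euc n) :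
    ‖torusExp b k x‖ = expScale b := by
  rw [torusExp_eq, norm_mul, Complex.norm_exp_ofReal_mul_I, mul_one, Complex.norm_real,
    Real.norm_of_nonneg (expScale_pos b).le]

theorem torusExp_mul {n : ℕ} (b : Module.Basis (Fin n) ℝ (Euc n)) (k l x : Euc n) :
    torusExp b k x * torusExp b l x = expScale b * torusExp b (k + l) x := by
  simp only [torusExp_eq]
  rw [inner_add_left, mul_add, Complex.ofReal_add, add_mul, Complex.exp_add]
  ring

theorem torusExp_mul_conj {n : ℕ} (b : Module.Basis (Fin n) ℝ (Euc n)) (k l x : Euc n) :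
    torusExp b k x * (starRingEnd ℂ) (torusExp b l x) = expScale b * torusExp b (k - l) x := by
  simp only [torusExp_eq, map_mul, Complex.conj_ofReal, ← Complex.exp_conj, Complex.conj_I]
  rw [inner_sub_left, mul_sub, Complex.ofReal_sub, sub_mul, sub_eq_add_neg, Complex.exp_add,
    ← mul_neg]
  ring

theorem continuous_torusExp {n : ℕ} (b : Module.Basis (Fin n) ℝ (Euc n)) (k : Euc n) :
    Continuous (torusExp b k) := by
  unfold torusExp
  fun_prop

theorem integrable_of_continuous {n : ℕ} (b : Module.Basis (Fin n) ℝ (Euc n)) {F : Type*}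
    [NormedAddCommGroup F] {g : Euc n → F} (hg : Continuous g) :
    Integrable g (torusMeasure b) := by
  have hc : IsCompact (closure (ZSpan.fundamentalDomain b)) :=
    (ZSpan.fundamentalDomain_isBounded b).isCompact_closure
  exact (hg.continuousOn.integrableOn_compact hc).mono_set subset_closure

theorem torusExp_add_right {n : ℕ} (b : Module.Basis (Fin n) ℝ (Euc n)) (k x y : Euc n) :
    torusExp b k (x + y) =
      Complex.exp (((2 * Real.pi * ⟪k, x⟫_ℝ : ℝ) : ℂ) * Complex.I) * torusExp b k y := by
  simp only [torusExp_eq]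
  rw [inner_add_right, mul_add, Complex.ofReal_add, add_mul, Complex.exp_add]
  ring

theorem torusExp_periodic {n : ℕ} (b : Module.Basis (Fin n) ℝ (Euc n)) {k : Euc n}
    (hk : k ∈ dualLattice b) {g : Euc n} (hg : g ∈ Submodule.span ℤ (Set.range b)) (x : Euc n) :
    torusExp b k (g + x) = torusExp b k x := by
  have h1 : ∃ m : ℤ, ⟪k, g⟫_ℝ = m := by
    induction hg using Submodule.span_induction with
    | mem y hy => obtain ⟨i, rfl⟩ := hy; exact hk i
    | zero => exact ⟨0, by simp⟩
    | add y z _ _ hy hz =>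
      obtain ⟨p, hp⟩ := hy
      obtain ⟨q, hq⟩ := hz
      exact ⟨p + q, by rw [inner_add_right, hp, hq]; push_cast; ring⟩
    | smul a y _ hy =>
      obtain ⟨p, hp⟩ := hy
      refine ⟨a * p, ?_⟩
      rw [← Int.cast_smul_eq_zsmul ℝ a y, inner_smul_right, hp]; push_cast; ring
  obtain ⟨m, hm⟩ := h1
  rw [torusExp_add_right, hm]
  have h2 : Complex.exp (((2 * Real.pi * (m : ℝ) : ℝ) : ℂ) * Complex.I) = 1 := by
    rw [Complex.exp_eq_one_iff]
    exact ⟨m, by push_cast; ring⟩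
  rw [h2, one_mul]

open scoped Pointwise in
/-- The integral of a nontrivial character over the torus vanishes, because a translation of the
fundamental domain multiplies it by a number different from `1`. -/
theorem integral_torusExp_eq_zero {n : ℕ} (b : Module.Basis (Fin n) ℝ (Euc n)) {k : Euc n}
    (hk : k ∈ dualLattice b) (hk0 : k ≠ 0) : ∫ x, torusExp b k x ∂(torusMeasure b) = 0 := by
  set D := ZSpan.fundamentalDomain b with hD
  have hfd := ZSpan.isAddFundamentalDomain' b (volume : Measure (Euc n))
  have : Countable (Submodule.span ℤ (Set.range b)).toAddSubgroup :=
    inferInstanceAs (Countable (Submodule.span ℤ (Set.range b)))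
  set t : Euc n := (2 * ‖k‖ ^ 2)⁻¹ • k with ht
  have hkt : ⟪k, t⟫_ℝ = 1 / 2 := by
    have : ‖k‖ ≠ 0 := norm_ne_zero_iff.2 hk0
    rw [ht, inner_smul_right, real_inner_self_eq_norm_sq]
    field_simp
  have hfd' : IsAddFundamentalDomain (Submodule.span ℤ (Set.range b)).toAddSubgroup (t +ᵥ D) volume :=
    hfd.vadd_of_comm t
  have h1 : ∫ x in D, torusExp b k x = ∫ x in t +ᵥ D, torusExp b k x :=
    hfd.setIntegral_eq hfd' fun g x => torusExp_periodic b hk g.2 x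
  have h2 : ∫ x in t +ᵥ D, torusExp b k x = ∫ x in D, torusExp b k (t + x) := by
    have h3 := (measurePreserving_add_left (volume : Measure (Euc n)) t).setIntegral_preimage_emb
      (measurableEmbedding_addLeft t) (torusExp b k) (t +ᵥ D)
    rw [← h3]
    congr 2
    ext x
    simp [Set.mem_vadd_set, vadd_eq_add]
  have h4 : ∀ x, torusExp b k (t + x) = -torusExp b k x := by
    intro x
    rw [torusExp_add_right, hkt]
    have : ((2 * Real.pi * (1 / 2) : ℝ) : ℂ) = Real.pi := by push_cast; ring
    rw [this, Complex.exp_pi_mul_I, neg_one_mul]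
  rw [h2] at h1
  simp only [h4, integral_neg] at h1
  rw [torusMeasure]
  exact self_eq_neg.1 h1

theorem sub_mem_dualLattice {n : ℕ} {b : Module.Basis (Fin n) ℝ (Euc n)} {k l : Euc n}
    (hk : k ∈ dualLattice b) (hl : l ∈ dualLattice b) : k - l ∈ dualLattice b := by
  intro i
  obtain ⟨p, hp⟩ := hk i
  obtain ⟨q, hq⟩ := hl i
  exact ⟨p - q, by rw [inner_sub_left, hp, hq]; push_cast; ring⟩

theorem add_mem_dualLattice {n : ℕ} {b : Module.Basis (Fin n) ℝ (Euc n)} {k l : Euc n}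
    (hk : k ∈ dualLattice b) (hl : l ∈ dualLattice b) : k + l ∈ dualLattice b := by
  intro i
  obtain ⟨p, hp⟩ := hk i
  obtain ⟨q, hq⟩ := hl i
  exact ⟨p + q, by rw [inner_add_left, hp, hq]; push_cast; ring⟩

theorem integral_torusExp_mul_conj {n : ℕ} (b : Module.Basis (Fin n) ℝ (Euc n)) {k l : Euc n}
    (hk : k ∈ dualLattice b) (hl : l ∈ dualLattice b) :
    ∫ x, torusExp b k x * (starRingEnd ℂ) (torusExp b l x) ∂(torusMeasure b) =
      if k = l then 1 else 0 := by
  simp only [torusExp_mul_conj]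
  rw [integral_const_mul]
  split_ifs with h
  · have h0 : ∀ x, torusExp b (0 : Euc n) x = expScale b := by intro x; simp [torusExp_eq]
    simp only [h, sub_self, h0, integral_const]
    rw [Complex.real_smul]
    have := expScale_sq_mul b
    rw [mul_left_comm, ← sq, mul_comm]
    exact_mod_cast this
  · rw [integral_torusExp_eq_zero b (sub_mem_dualLattice hk hl) (sub_ne_zero.2 h), mul_zero]

/-- The trigonometric polynomial with frequencies in `S` and coefficients `a`. -/
noncomputable def trigPoly {n : ℕ} (b : Module.Basis (Fin n) ℝ (Euc n)) (S : Finset (Euc n))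
    (a : Euc n → ℂ) (x : Euc n) : ℂ := ∑ k ∈ S, a k * torusExp b k x

theorem continuous_trigPoly {n : ℕ} (b : Module.Basis (Fin n) ℝ (Euc n)) (S : Finset (Euc n))
    (a : Euc n → ℂ) : Continuous (trigPoly b S a) :=
  continuous_finsetSum _ fun k _ => continuous_const.mul (continuous_torusExp b k)

theorem integral_norm_trigPoly_sq {n : ℕ} (b : Module.Basis (Fin n) ℝ (Euc n))
    {S : Finset (Euc n)} (hS : (S : Set (Euc n)) ⊆ dualLattice b) (a : Euc n → ℂ) :
    ∫ x, ‖trigPoly b S a x‖ ^ 2 ∂(torusMeasure b) = ∑ k ∈ S, ‖a k‖ ^ 2 := by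
  classical
  have h1 : ∀ x, ((‖trigPoly b S a x‖ ^ 2 : ℝ) : ℂ) = ∑ k ∈ S, ∑ l ∈ S,
      a k * (starRingEnd ℂ) (a l) * (torusExp b k x * (starRingEnd ℂ) (torusExp b l x)) := by
    intro x
    rw [Complex.ofReal_pow, ← Complex.mul_conj', trigPoly, map_sum, Finset.sum_mul_sum]
    refine Finset.sum_congr rfl fun k _ => Finset.sum_congr rfl fun l _ => ?_
    rw [map_mul]; ring
  have hint : ∀ k l, Integrable (fun x => a k * (starRingEnd ℂ) (a l) *
      (torusExp b k x * (starRingEnd ℂ) (torusExp b l x))) (torusMeasure b) := fun k l =>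
    integrable_of_continuous b (continuous_const.mul ((continuous_torusExp b k).mul
      (Complex.continuous_conj.comp (continuous_torusExp b l))))
  have h2 : ((∫ x, ‖trigPoly b S a x‖ ^ 2 ∂(torusMeasure b) : ℝ) : ℂ) =
      ((∑ k ∈ S, ‖a k‖ ^ 2 : ℝ) : ℂ) := by
    rw [← integral_complex_ofReal]
    simp only [h1]
    rw [integral_finsetSum _ fun k _ => integrable_finsetSum _ fun l _ => hint k l,
      Complex.ofReal_sum]
    refine Finset.sum_congr rfl fun k hk => ?_
    rw [integral_finsetSum _ fun l _ => hint k l, Finset.sum_eq_single_of_mem k hk]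
    · rw [integral_const_mul, integral_torusExp_mul_conj b (hS hk) (hS hk), if_pos rfl, mul_one,
        Complex.mul_conj', Complex.ofReal_pow]
    · intro l hl hne
      rw [integral_const_mul, integral_torusExp_mul_conj b (hS hk) (hS hl), if_neg hne.symm,
        mul_zero]
  exact_mod_cast h2

theorem lintegral_enorm_sq_eq {n : ℕ} (b : Module.Basis (Fin n) ℝ (Euc n)) {g : Euc n → ℂ}
    (hg : Continuous g) :
    ∫⁻ x, ‖g x‖ₑ ^ 2 ∂(torusMeasure b) = ENNReal.ofReal (∫ x, ‖g x‖ ^ 2 ∂(torusMeasure b)) := by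
  rw [ofReal_integral_eq_lintegral_ofReal (integrable_of_continuous b (by fun_prop))
    (Filter.Eventually.of_forall fun x => by positivity)]
  refine lintegral_congr fun x => ?_
  rw [ENNReal.ofReal_pow (norm_nonneg _), ofReal_norm]

theorem eLpNorm_trigPoly_two {n : ℕ} (b : Module.Basis (Fin n) ℝ (Euc n))
    {S : Finset (Euc n)} (hS : (S : Set (Euc n)) ⊆ dualLattice b) (a : Euc n → ℂ) :
    eLpNorm (trigPoly b S a) 2 (torusMeasure b) = ENNReal.ofReal √(∑ k ∈ S, ‖a k‖ ^ 2) := by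
  rw [eLpNorm_eq_lintegral_rpow_enorm_toReal (by norm_num) (by norm_num)]
  have h1 : ∀ x, ‖trigPoly b S a x‖ₑ ^ (2 : ENNReal).toReal = ‖trigPoly b S a x‖ₑ ^ 2 := by
    intro x; simp
  simp only [h1]
  rw [lintegral_enorm_sq_eq b (continuous_trigPoly b S a), integral_norm_trigPoly_sq b hS,
    Real.sqrt_eq_rpow, ENNReal.ofReal_rpow_of_nonneg (by positivity) (by positivity)]
  simp

theorem norm_trigPoly_le {n : ℕ} (b : Module.Basis (Fin n) ℝ (Euc n)) (S : Finset (Euc n))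
    (a : Euc n → ℂ) (x : Euc n) :
    ‖trigPoly b S a x‖ ≤ expScale b * (√S.card * √(∑ k ∈ S, ‖a k‖ ^ 2)) := by
  have h1 : ‖trigPoly b S a x‖ ≤ expScale b * ∑ k ∈ S, ‖a k‖ := by
    rw [Finset.mul_sum]
    refine (norm_sum_le _ _).trans (Finset.sum_le_sum fun k _ => ?_)
    rw [norm_mul, norm_torusExp, mul_comm]
  refine h1.trans (mul_le_mul_of_nonneg_left ?_ (expScale_pos b).le)
  rw [← Real.sqrt_mul (Nat.cast_nonneg _)]
  exact Real.le_sqrt_of_sq_le sq_sum_le_card_mul_sum_sq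

/-- The product of two trigonometric polynomials is bounded in `L²` by the largest number of
representations of a frequency as a sum of a frequency of each. -/
theorem integral_norm_mul_sq_le {n : ℕ} (b : Module.Basis (Fin n) ℝ (Euc n))
    {S S' : Finset (Euc n)} (hS : (S : Set (Euc n)) ⊆ dualLattice b)
    (hS' : (S' : Set (Euc n)) ⊆ dualLattice b) (a a' : Euc n → ℂ) {X : ℝ}
    (hX : ∀ m, (((S ×ˢ S').filter fun p => p.1 + p.2 = m).card : ℝ) ≤ X) :
    ∫ x, ‖trigPoly b S a x * trigPoly b S' a' x‖ ^ 2 ∂(torusMeasure b) ≤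
      expScale b ^ 2 * X * ((∑ k ∈ S, ‖a k‖ ^ 2) * ∑ k ∈ S', ‖a' k‖ ^ 2) := by
  classical
  set M : Finset (Euc n) := (S ×ˢ S').image fun p => p.1 + p.2 with hM
  have hmaps : ∀ p ∈ S ×ˢ S', p.1 + p.2 ∈ M := fun p hp => Finset.mem_image_of_mem _ hp
  have hMdual : (M : Set (Euc n)) ⊆ dualLattice b := by
    intro m hm
    rw [Finset.mem_coe, hM, Finset.mem_image] at hm
    obtain ⟨p, hp, rfl⟩ := hm
    rw [Finset.mem_product] at hp
    exact add_mem_dualLattice (hS hp.1) (hS' hp.2)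
  set d : Euc n → ℂ := fun m => expScale b *
    ∑ p ∈ (S ×ˢ S').filter (fun p => p.1 + p.2 = m), a p.1 * a' p.2 with hd
  have h1 : ∀ x, trigPoly b S a x * trigPoly b S' a' x = trigPoly b M d x := by
    intro x
    rw [trigPoly, trigPoly, Finset.sum_mul_sum, ← Finset.sum_product',
      ← Finset.sum_fiberwise_of_maps_to hmaps, trigPoly]
    refine Finset.sum_congr rfl fun m _ => ?_
    simp only [d, Finset.mul_sum, Finset.sum_mul]
    refine Finset.sum_congr rfl fun p hp => ?_
    rw [← (Finset.mem_filter.1 hp).2]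
    linear_combination (a p.1 * a' p.2) * torusExp_mul b p.1 p.2 x
  simp only [h1]
  rw [integral_norm_trigPoly_sq b hMdual]
  calc ∑ m ∈ M, ‖d m‖ ^ 2
      ≤ ∑ m ∈ M, expScale b ^ 2 * X *
        ∑ p ∈ (S ×ˢ S').filter (fun p => p.1 + p.2 = m), ‖a p.1‖ ^ 2 * ‖a' p.2‖ ^ 2 := by
        refine Finset.sum_le_sum fun m _ => ?_
        rw [hd, norm_mul, mul_pow, Complex.norm_real, Real.norm_of_nonneg (expScale_pos b).le,
          mul_assoc]
        refine mul_le_mul_of_nonneg_left ?_ (sq_nonneg _)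
        calc _ ≤ (∑ p ∈ (S ×ˢ S').filter (fun p => p.1 + p.2 = m), ‖a p.1 * a' p.2‖) ^ 2 :=
              pow_le_pow_left₀ (norm_nonneg _) (norm_sum_le _ _) _
          _ ≤ _ := sq_sum_le_card_mul_sum_sq
          _ ≤ _ := by
              simp only [norm_mul, mul_pow]
              exact mul_le_mul_of_nonneg_right (hX m)
                (Finset.sum_nonneg fun p _ => by positivity)
    _ = expScale b ^ 2 * X * ∑ p ∈ S ×ˢ S', ‖a p.1‖ ^ 2 * ‖a' p.2‖ ^ 2 := by
        rw [← Finset.mul_sum, Finset.sum_fiberwise_of_maps_to hmaps]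
    _ = _ := by rw [Finset.sum_mul_sum, ← Finset.sum_product']

/-- Interpolation between the Cauchy–Schwarz bound in `L¹` and the bound in `L³` that comes from
the bounds in `L²` and `L^∞`. -/
theorem lintegral_enorm_mul_rpow_le {n : ℕ} (b : Module.Basis (Fin n) ℝ (Euc n))
    {S S' : Finset (Euc n)} (hS : (S : Set (Euc n)) ⊆ dualLattice b)
    (hS' : (S' : Set (Euc n)) ⊆ dualLattice b) (a a' : Euc n → ℂ) {X Y β : ℝ}
    (hβ : 0 ≤ β) (hβ1 : β ≤ 1) (hY : (S.card : ℝ) ≤ Y) (hY' : (S'.card : ℝ) ≤ Y)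
    (hX : ∀ m, (((S ×ˢ S').filter fun p => p.1 + p.2 = m).card : ℝ) ≤ X) :
    ∫⁻ x, ‖trigPoly b S a x * trigPoly b S' a' x‖ₑ ^ (1 + 2 * β) ∂(torusMeasure b) ≤
      ENNReal.ofReal ((expScale b ^ 4 * (Y * X)) ^ β *
        (√(∑ k ∈ S, ‖a k‖ ^ 2) * √(∑ k ∈ S', ‖a' k‖ ^ 2)) ^ (1 + 2 * β)) := by
  set F := trigPoly b S a with hF
  set G := trigPoly b S' a' with hG
  have hFc : Continuous F := continuous_trigPoly b S a
  have hGc : Continuous G := continuous_trigPoly b S' a'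
  set α₁ : ℝ := ∑ k ∈ S, ‖a k‖ ^ 2 with hα₁
  set α₂ : ℝ := ∑ k ∈ S', ‖a' k‖ ^ 2 with hα₂
  have hα₁0 : 0 ≤ α₁ := Finset.sum_nonneg fun _ _ => by positivity
  have hα₂0 : 0 ≤ α₂ := Finset.sum_nonneg fun _ _ => by positivity
  set A : ℝ := √α₁ * √α₂ with hA
  have hA0 : 0 ≤ A := by positivity
  have hA2 : A ^ 2 = α₁ * α₂ := by rw [hA, mul_pow, Real.sq_sqrt hα₁0, Real.sq_sqrt hα₂0]
  have hX0 : 0 ≤ X := (Nat.cast_nonneg _).trans (hX 0)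
  have hY0 : 0 ≤ Y := (Nat.cast_nonneg _).trans hY
  have hσ := expScale_pos b
  have hL1 : ∫⁻ x, ‖F x * G x‖ₑ ∂(torusMeasure b) ≤ ENNReal.ofReal A := by
    have h := ENNReal.lintegral_mul_le_Lp_mul_Lq (torusMeasure b) Real.HolderConjugate.two_two
      (f := fun x => ‖F x‖ₑ) (g := fun x => ‖G x‖ₑ) hFc.enorm.aemeasurable hGc.enorm.aemeasurable
    simp only [Pi.mul_apply, ENNReal.rpow_two] at h
    rw [lintegral_enorm_sq_eq b hFc, lintegral_enorm_sq_eq b hGc, hF, hG,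
      integral_norm_trigPoly_sq b hS, integral_norm_trigPoly_sq b hS',
      ENNReal.ofReal_rpow_of_nonneg hα₁0 (by norm_num),
      ENNReal.ofReal_rpow_of_nonneg hα₂0 (by norm_num), ← Real.sqrt_eq_rpow,
      ← Real.sqrt_eq_rpow, ← ENNReal.ofReal_mul (Real.sqrt_nonneg _)] at h
    simpa only [enorm_mul] using h
  have hsup : ∀ x, ‖F x * G x‖ ≤ expScale b ^ 2 * (Y * A) := by
    intro x
    have h1 : √(S.card : ℝ) ≤ √Y := Real.sqrt_le_sqrt hY
    have h2 : √(S'.card : ℝ) ≤ √Y := Real.sqrt_le_sqrt hY'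
    rw [norm_mul]
    calc _ ≤ (expScale b * (√S.card * √α₁)) * (expScale b * (√S'.card * √α₂)) := by
          gcongr
          · exact norm_trigPoly_le b S a x
          · exact norm_trigPoly_le b S' a' x
      _ ≤ (expScale b * (√Y * √α₁)) * (expScale b * (√Y * √α₂)) := by gcongr
      _ = expScale b ^ 2 * ((√Y * √Y) * A) := by rw [hA]; ring
      _ = _ := by rw [Real.mul_self_sqrt hY0]
  have hL3 : ∫⁻ x, ‖F x * G x‖ₑ ^ 3 ∂(torusMeasure b) ≤
      ENNReal.ofReal (expScale b ^ 4 * (Y * X) * A ^ 3) := by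
    calc ∫⁻ x, ‖F x * G x‖ₑ ^ 3 ∂(torusMeasure b)
        ≤ ∫⁻ x, ENNReal.ofReal (expScale b ^ 2 * (Y * A)) * ‖F x * G x‖ₑ ^ 2
            ∂(torusMeasure b) := by
          refine lintegral_mono fun x => ?_
          rw [pow_succ']
          gcongr
          rw [← ofReal_norm]
          exact ENNReal.ofReal_le_ofReal (hsup x)
      _ = ENNReal.ofReal (expScale b ^ 2 * (Y * A)) *
          ENNReal.ofReal (∫ x, ‖F x * G x‖ ^ 2 ∂(torusMeasure b)) := by
          have h := lintegral_enorm_sq_eq b (hFc.mul hGc)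
          simp only [Pi.mul_apply] at h
          rw [lintegral_const_mul' _ _ ENNReal.ofReal_ne_top, h]
      _ ≤ ENNReal.ofReal (expScale b ^ 2 * (Y * A)) *
          ENNReal.ofReal (expScale b ^ 2 * X * (α₁ * α₂)) := by
          gcongr
          exact integral_norm_mul_sq_le b hS hS' a a' hX
      _ = _ := by
          rw [← ENNReal.ofReal_mul (by positivity), ← hA2]
          congr 1; ring
  have hint := ENNReal.lintegral_mul_norm_pow_le (μ := torusMeasure b)
    (f := fun x => ‖F x * G x‖ₑ) (g := fun x => ‖F x * G x‖ₑ ^ 3)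
    (hFc.mul hGc).enorm.aemeasurable ((hFc.mul hGc).enorm.aemeasurable.pow_const 3)
    (sub_nonneg.2 hβ1) hβ (by ring)
  have hpt : ∀ x, ‖F x * G x‖ₑ ^ (1 + 2 * β) =
      ‖F x * G x‖ₑ ^ (1 - β) * (‖F x * G x‖ₑ ^ 3) ^ β := by
    intro x
    rw [← ENNReal.rpow_natCast, ← ENNReal.rpow_mul,
      ← ENNReal.rpow_add_of_nonneg _ _ (sub_nonneg.2 hβ1) (by positivity)]
    congr 1; push_cast; ring
  simp only [hpt]
  refine hint.trans ?_
  clear_value A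
  calc _ ≤ ENNReal.ofReal A ^ (1 - β) *
        ENNReal.ofReal (expScale b ^ 4 * (Y * X) * A ^ 3) ^ β := by
        gcongr
    _ = ENNReal.ofReal (A ^ (1 - β) * (expScale b ^ 4 * (Y * X) * A ^ 3) ^ β) := by
        rw [ENNReal.ofReal_rpow_of_nonneg hA0 (sub_nonneg.2 hβ1),
          ENNReal.ofReal_rpow_of_nonneg (by positivity) hβ, ← ENNReal.ofReal_mul (by positivity)]
    _ = _ := by
        congr 1
        rw [Real.mul_rpow (by positivity) (by positivity), ← Real.rpow_natCast A 3,
          ← Real.rpow_mul hA0, mul_left_comm,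
          ← Real.rpow_add_of_nonneg hA0 (sub_nonneg.2 hβ1) (by positivity)]
        congr 2; push_cast; ring

theorem torusMultiplier_eq_trigPoly {n : ℕ} (b : Module.Basis (Fin n) ℝ (Euc n))
    {m : Euc n → ℝ} {S : Finset (Euc n)} (hS : (S : Set (Euc n)) ⊆ dualLattice b)
    (hm : ∀ k ∈ dualLattice b, k ∉ S → m ((2 * Real.pi) • k) = 0) (f : Euc n → ℂ) :
    torusMultiplier b m f =
      trigPoly b S fun k => ((m ((2 * Real.pi) • k) : ℝ) : ℂ) * torusCoeff b f k := by
  classical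
  funext x
  rw [torusMultiplier, trigPoly, tsum_eq_sum (s := S.subtype (· ∈ dualLattice b))]
  · rw [Finset.sum_subtype_of_mem (f := fun k => ((m ((2 * Real.pi) • k) : ℝ) : ℂ) *
      torusCoeff b f k * torusExp b k x) fun k hk => hS hk]
  · intro k hk
    rw [Finset.mem_subtype] at hk
    rw [hm k k.2 hk]; simp

/-! ### The bilinear estimate -/

/-- The gain: the count of the frequencies and of the representations, for all radii. The
product of the two would be `O(R^{2n-2})` in general. -/
theorem exists_ncard_mul_ncard_le (n : ℕ) (hn : 2 ≤ n) (b : Module.Basis (Fin n) ℝ (Euc n))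
    {η κ τ K c s : ℝ} (hη : 0 < η) (hη₀ : η ≤ 1 / (12 * ((n : ℝ) * n + 2))) (hητ : η < τ)
    (hκ : 0 < κ) (hK : 1 ≤ K) (hc : 0 < c) (hs : 0 < s) :
    ∃ C > (0 : ℝ), ∀ (lam δ R : ℝ), 1 ≤ lam → lam ^ (-1 + κ) ≤ δ → δ ≤ 1 →
      R = (lam * δ) ^ (1 / 2 : ℝ) →
      ∀ (ι : Type) [Fintype ι] (Ω : ι → Box n), (∀ i, (Ω i).IsCap K lam δ) →
      (∀ ξ, ({i | ξ ∈ (Ω i).points}.ncard : ℝ) ≤ K) →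
      (δ ≤ lam ^ (-τ) ∨ ∀ i, c * R ^ (n - 1) ≤ R ^ (2 * η) * (Ω i).count b →
        (Ω i).latticeDim b = n - 1) →
      ∀ Γ Γ' : Set (Euc n), Γ ⊆ polarDirections n → Γ' ⊆ polarDirections n →
      (∀ u ∈ Γ, ∀ u' ∈ Γ', s * δ ≤ ‖u - u'‖) →
      ∃ X Y : ℝ, Y * X ≤ C * R ^ (2 * (n : ℝ) - 5 / 2) ∧
      ((badFrequencies b c R (R ^ (2 * η)) lam δ Ω Γ).ncard : ℝ) ≤ Y ∧
      ((badFrequencies b c R (R ^ (2 * η)) lam δ Ω Γ').ncard : ℝ) ≤ Y ∧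
      ∀ m, ({ξ | ξ ∈ badFrequencies b c R (R ^ (2 * η)) lam δ Ω Γ ∧
          m - ξ ∈ badFrequencies b c R (R ^ (2 * η)) lam δ Ω Γ'}.ncard : ℝ) ≤ X := by
  obtain ⟨C, hC, hmain⟩ := exists_ncard_badFrequencies_le n hn b hK hc hs
  obtain ⟨B, hB, hball⟩ := exists_ncard_frequency_ball_le b
  have hC0 : 0 < C := by linarith
  set lam₀ : ℝ := C ^ (4 / κ) + C ^ (1 / (τ - η)) with hlam₀
  have hl1 : 0 < C ^ (4 / κ) := Real.rpow_pos_of_pos hC0 _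
  have hl2 : 0 < C ^ (1 / (τ - η)) := Real.rpow_pos_of_pos hC0 _
  set Y₀ : ℝ := B * (lam₀ + 1) ^ n with hY₀
  have hn2 : (2 : ℝ) ≤ n := by exact_mod_cast hn
  have hY₀0 : 0 ≤ Y₀ := by positivity
  refine ⟨C ^ 2 + Y₀ ^ 2, by positivity, ?_⟩
  intro lam δ R hlam hδκ hδ1 hR ι _ Ω hcap hoverlap hdim Γ Γ' hΓ hΓ' hsep
  have hlam0 : 0 < lam := by linarith
  have hδ : 0 < δ := (Real.rpow_pos_of_pos hlam0 _).trans_le hδκ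
  have hlk : lam ^ κ ≤ lam * δ := by
    calc lam ^ κ = lam * lam ^ (-1 + κ) := by
          rw [Real.rpow_add hlam0, Real.rpow_neg_one, ← mul_assoc, mul_inv_cancel₀ hlam0.ne',
            one_mul]
      _ ≤ _ := by gcongr
  have hld : 1 ≤ lam * δ := (Real.one_le_rpow hlam hκ.le).trans hlk
  obtain ⟨hR2, hR1, hδR⟩ := one_le_and_le_of_eq_rpow_half hδ1 hld hR
  have hR0 : 0 < R := by linarith
  set q : ℝ := R ^ (2 * η) with hq
  have hq1 : 1 ≤ q := Real.one_le_rpow hR1 (by linarith)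
  have hexp : 1 ≤ R ^ (2 * (n : ℝ) - 5 / 2) := Real.one_le_rpow hR1 (by linarith)
  rcases lt_or_ge lam lam₀ with hsmall | hlarge
  · -- bounded radii: all frequencies of the annulus lie in a fixed ball
    obtain ⟨hfin, hcard⟩ := hball (lam₀ + 1) (by linarith)
    have hsub : ∀ Δ, badFrequencies b c R q lam δ Ω Δ ⊆
        {x | x ∈ frequencyLattice b ∧ ‖x‖ ≤ lam₀ + 1} := by
      rintro Δ x ⟨hx, hxs, -⟩
      have hann : |‖x‖ - lam| < δ := hxs.1
      exact ⟨hx, by have := (abs_lt.1 hann).2; linarith⟩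
    have hle : ∀ T ⊆ {x | x ∈ frequencyLattice b ∧ ‖x‖ ≤ lam₀ + 1}, (T.ncard : ℝ) ≤ Y₀ :=
      fun T hT => le_trans (by exact_mod_cast Set.ncard_le_ncard hT hfin) hcard
    refine ⟨Y₀, Y₀, ?_, hle _ (hsub Γ), hle _ (hsub Γ'), fun m =>
      hle _ (fun x hx => hsub Γ hx.1)⟩
    calc Y₀ * Y₀ ≤ (C ^ 2 + Y₀ ^ 2) * 1 := by nlinarith [sq_nonneg C]
      _ ≤ _ := by gcongr
  · have hE : (0 : ℝ) < 12 * ((n : ℝ) * n + 2) := by positivity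
    have hηE : 6 * ((n : ℝ) * n + 2) * η ≤ 1 / 2 := by
      rw [le_div_iff₀ hE] at hη₀
      linarith
    have hη4 : 2 * η ≤ 1 / 2 := by nlinarith
    have hCqR : C * q ≤ R := by
      have h1 : C ≤ R ^ (1 / 2 : ℝ) := by
        have h2 : C ^ (4 / κ) ≤ lam := by linarith
        have h3 : C ^ (4 : ℝ) ≤ lam ^ κ := by
          calc C ^ (4 : ℝ) = (C ^ (4 / κ)) ^ κ := by
                rw [← Real.rpow_mul hC0.le]; congr 1; field_simp
            _ ≤ _ := Real.rpow_le_rpow hl1.le h2 hκ.le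
        have h4 : (C ^ (4 : ℝ)) ^ (1 / 4 : ℝ) ≤ (R ^ 2) ^ (1 / 4 : ℝ) := by
          rw [hR2]
          exact Real.rpow_le_rpow (by positivity) (h3.trans hlk) (by norm_num)
        rw [← Real.rpow_mul hC0.le, ← Real.rpow_natCast, ← Real.rpow_mul hR0.le] at h4
        norm_num at h4 ⊢
        exact h4
      calc C * q ≤ R ^ (1 / 2 : ℝ) * R ^ (1 / 2 : ℝ) :=
            mul_le_mul h1 (Real.rpow_le_rpow_of_exponent_le hR1 hη4) (by positivity) (by positivity)
        _ = R := by rw [← Real.rpow_add hR0]; norm_num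
    have hdim' : C * (q * δ) < 1 ∨ ∀ i, c * R ^ (n - 1) ≤ q * (Ω i).count b →
        (Ω i).latticeDim b = n - 1 := by
      refine hdim.imp (fun h => ?_) id
      have hτη : 0 < τ - η := by linarith
      have h1 : C < lam ^ (τ - η) := by
        have h2 : C ^ (1 / (τ - η)) < lam := by linarith
        calc C = (C ^ (1 / (τ - η))) ^ (τ - η) := by
              rw [← Real.rpow_mul hC0.le, one_div_mul_cancel hτη.ne', Real.rpow_one]
          _ < _ := Real.rpow_lt_rpow hl2.le h2 hτη
      have h3 : q ≤ lam ^ η := by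
        calc q = (R ^ 2) ^ η := by
              rw [hq, ← Real.rpow_natCast, ← Real.rpow_mul hR0.le]; norm_num
          _ ≤ lam ^ η := by
              rw [hR2]
              exact Real.rpow_le_rpow (by positivity)
                (mul_le_of_le_one_right hlam0.le hδ1) hη.le
      calc C * (q * δ) ≤ C * (lam ^ η * lam ^ (-τ)) := by gcongr
        _ < lam ^ (τ - η) * (lam ^ η * lam ^ (-τ)) := by gcongr
        _ = 1 := by
          rw [← Real.rpow_add hlam0, ← Real.rpow_add hlam0,
            show τ - η + (η + -τ) = 0 by ring, Real.rpow_zero]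
    obtain ⟨h1, h2, h3⟩ := hmain lam δ R q hlam hδ hδ1 hld hR hq1 hCqR ι Ω hcap hoverlap hdim'
      Γ Γ' hΓ hΓ' hsep
    refine ⟨_, _, ?_, h1, h2, h3⟩
    set E : ℕ := n * n + 2 with hEdef
    have hqE : q ^ (3 * E) ≤ R ^ (1 / 2 : ℝ) := by
      rw [hq, ← Real.rpow_natCast, ← Real.rpow_mul hR0.le]
      refine Real.rpow_le_rpow_of_exponent_le hR1 ?_
      rw [hEdef]; push_cast
      linarith
    have hRn : R ^ (n - 1) * R ^ (n - 2) = R ^ (2 * (n : ℝ) - 3) := by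
      rw [← pow_add, ← Real.rpow_natCast]
      congr 1
      obtain ⟨m, rfl⟩ : ∃ m, n = m + 2 := ⟨n - 2, by omega⟩
      simp only [Nat.add_sub_cancel, show m + 2 - 1 = m + 1 by omega]
      push_cast; ring
    calc C * (q ^ E * R ^ (n - 1)) * (C * (q ^ (2 * E) * R ^ (n - 2)))
        = C ^ 2 * (q ^ (3 * E) * (R ^ (n - 1) * R ^ (n - 2))) := by
          rw [show 3 * E = E + 2 * E by ring, pow_add]; ring
      _ ≤ C ^ 2 * (R ^ (1 / 2 : ℝ) * R ^ (2 * (n : ℝ) - 3)) := by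
          rw [hRn]; gcongr
      _ = C ^ 2 * R ^ (2 * (n : ℝ) - 5 / 2) := by
          rw [← Real.rpow_add hR0]; congr 2; ring
      _ ≤ _ := by gcongr; nlinarith

theorem exists_finset_two_pi_smul_mem {n : ℕ} {Z : Set (Euc n)} (hZ : Z.Finite) :
    ∃ S : Finset (Euc n), (∀ k, k ∈ S ↔ (2 * Real.pi) • k ∈ Z) ∧ S.card = Z.ncard := by
  classical
  have hπ : (2 * Real.pi) ≠ 0 := Real.two_pi_pos.ne'
  refine ⟨hZ.toFinset.image fun ξ => (2 * Real.pi)⁻¹ • ξ, fun k => ?_, ?_⟩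
  · simp only [Finset.mem_image, Set.Finite.mem_toFinset]
    constructor
    · rintro ⟨ξ, hξ, rfl⟩; rwa [smul_inv_smul₀ hπ]
    · intro h; exact ⟨_, h, inv_smul_smul₀ hπ k⟩
  · rw [Finset.card_image_of_injective _ (smul_right_injective _ (inv_ne_zero hπ)),
      Set.ncard_eq_toFinset_card Z hZ]

theorem two_pi_smul_mem_frequencyLattice {n : ℕ} {b : Module.Basis (Fin n) ℝ (Euc n)}
    {k : Euc n} : (2 * Real.pi) • k ∈ frequencyLattice b ↔ k ∈ dualLattice b := by
  constructor
  · rintro ⟨l, hl, hlk⟩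
    have : l = k := smul_right_injective _ Real.two_pi_pos.ne' hlk
    rwa [← this]
  · exact fun h => ⟨k, h, rfl⟩

theorem card_filter_add_eq_le {n : ℕ} {Z Z' : Set (Euc n)} (hZ : Z.Finite)
    {S S' : Finset (Euc n)} (hS : ∀ k, k ∈ S ↔ (2 * Real.pi) • k ∈ Z)
    (hS' : ∀ k, k ∈ S' ↔ (2 * Real.pi) • k ∈ Z') (m : Euc n) :
    ((S ×ˢ S').filter fun p => p.1 + p.2 = m).card ≤
      {ξ | ξ ∈ Z ∧ (2 * Real.pi) • m - ξ ∈ Z'}.ncard := by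
  rw [← Set.ncard_coe_finset]
  refine Set.ncard_le_ncard_of_injOn (fun p => (2 * Real.pi) • p.1) ?_ ?_
    (hZ.subset fun x hx => hx.1)
  · intro p hp
    rw [Finset.mem_coe, Finset.mem_filter, Finset.mem_product] at hp
    refine ⟨(hS _).1 hp.1.1, ?_⟩
    rw [← smul_sub, ← hp.2, add_sub_cancel_left]
    exact (hS' _).1 hp.1.2
  · intro p hp p' hp' h
    rw [Finset.mem_coe, Finset.mem_filter] at hp hp'
    have h1 : p.1 = p'.1 := smul_right_injective _ Real.two_pi_pos.ne' h
    have h2 : p.2 = p'.2 := by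
      have := hp.2.trans hp'.2.symm
      rw [h1] at this
      exact add_left_cancel this
    exact Prod.ext h1 h2

theorem finite_frequencies_sector {n : ℕ} (b : Module.Basis (Fin n) ℝ (Euc n)) {lam δ : ℝ}
    (hlam : 1 ≤ lam) (hδ : 0 < δ) (Γ : Set (Euc n)) :
    {ξ | ξ ∈ frequencyLattice b ∧ ξ ∈ sector lam δ Γ}.Finite := by
  obtain ⟨B, -, hball⟩ := exists_ncard_frequency_ball_le b
  refine (hball (lam + δ) (by linarith)).1.subset ?_
  rintro x ⟨hx, hxs⟩
  have hann : |‖x‖ - lam| < δ := hxs.1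
  exact ⟨hx, by have := (abs_lt.1 hann).2; linarith⟩

theorem eLpNorm_norm_rpow_half {α : Type*} [MeasurableSpace α] {μ : Measure α} (g : α → ℂ)
    {p : ℝ} (hp : 0 < p) :
    eLpNorm (fun x => ‖g x‖ ^ (1 / 2 : ℝ)) (ENNReal.ofReal p) μ =
      (∫⁻ x, ‖g x‖ₑ ^ (p / 2) ∂μ) ^ (1 / p) := by
  rw [eLpNorm_eq_lintegral_rpow_enorm_toReal (by simpa using hp) ENNReal.ofReal_ne_top,
    ENNReal.toReal_ofReal hp.le]
  congr 2
  funext x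
  rw [Real.enorm_of_nonneg (by positivity),
    ← ENNReal.ofReal_rpow_of_nonneg (norm_nonneg _) (by norm_num), ofReal_norm,
    ← ENNReal.rpow_mul]
  congr 1; ring

/-- A multiplier bounded by the indicator of the sector, and vanishing outside of `Z`, is a
trigonometric polynomial with frequencies in `Z / 2π` whose coefficients have a smaller square sum
than those of the projection on the sector. -/
theorem exists_torusMultiplier_eq {n : ℕ} (b : Module.Basis (Fin n) ℝ (Euc n)) {lam δ : ℝ}
    (hlam : 1 ≤ lam) (hδ : 0 < δ) (Γ : Set (Euc n)) {m : Euc n → ℝ} {Z : Set (Euc n)}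
    (hZ : Z ⊆ {ξ | ξ ∈ frequencyLattice b ∧ ξ ∈ sector lam δ Γ})
    (hm1 : ∀ ξ ∈ Z, |m ξ| ≤ 1) (hm0 : ∀ ξ ∈ frequencyLattice b, ξ ∉ Z → m ξ = 0)
    (f : Euc n → ℂ) :
    ∃ (S : Finset (Euc n)) (a : Euc n → ℂ), (S : Set (Euc n)) ⊆ dualLattice b ∧
      (∀ k, k ∈ S ↔ (2 * Real.pi) • k ∈ Z) ∧ S.card = Z.ncard ∧
      torusMultiplier b m f = trigPoly b S a ∧
      ENNReal.ofReal √(∑ k ∈ S, ‖a k‖ ^ 2) ≤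
        eLpNorm (sectorProj b lam δ Γ f) 2 (torusMeasure b) := by
  have hfin := finite_frequencies_sector b hlam hδ Γ
  obtain ⟨S, hS, hScard⟩ := exists_finset_two_pi_smul_mem (hfin.subset hZ)
  obtain ⟨T, hT, -⟩ := exists_finset_two_pi_smul_mem hfin
  have hTdual : (T : Set (Euc n)) ⊆ dualLattice b := fun k hk =>
    two_pi_smul_mem_frequencyLattice.1 ((hT k).1 hk).1
  have hST : S ⊆ T := fun k hk => (hT k).2 (hZ ((hS k).1 hk))
  have hSdual : (S : Set (Euc n)) ⊆ dualLattice b := fun k hk => hTdual (hST hk)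
  refine ⟨S, fun k => ((m ((2 * Real.pi) • k) : ℝ) : ℂ) * torusCoeff b f k, hSdual, hS, hScard,
    torusMultiplier_eq_trigPoly b hSdual (fun k hk hkS => hm0 _
      (two_pi_smul_mem_frequencyLattice.2 hk) (fun h => hkS ((hS k).2 h))) f, ?_⟩
  rw [sectorProj, torusMultiplier_eq_trigPoly b hTdual (fun k hk hkT => ?_) f,
    eLpNorm_trigPoly_two b hTdual]
  · refine ENNReal.ofReal_le_ofReal (Real.sqrt_le_sqrt ?_)
    refine (Finset.sum_le_sum fun k hk => ?_).trans
      (Finset.sum_le_sum_of_subset_of_nonneg hST fun _ _ _ => by positivity)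
    rw [Set.indicator_of_mem (hZ ((hS k).1 hk)).2, norm_mul, norm_mul]
    gcongr
    rw [Complex.norm_real, Complex.ofReal_one, norm_one]
    exact hm1 _ ((hS k).1 hk)
  · refine Set.indicator_of_notMem (fun h => hkT ((hT k).2 ⟨?_, h⟩)) _
    exact two_pi_smul_mem_frequencyLattice.2 hk

theorem isBad_iff {n : ℕ} (hn : 1 ≤ n) (b : Module.Basis (Fin n) ℝ (Euc n)) {c η lam δ R : ℝ}
    (hld : 0 < lam * δ) (hR : R = (lam * δ) ^ (1 / 2 : ℝ)) (Q : Box n) :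
    Q.IsBad b c η lam δ ↔ c * R ^ (n - 1) ≤ R ^ (2 * η) * Q.count b := by
  have h1 : (lam * δ) ^ (((n : ℝ) - 1) / 2 - η) = R ^ (n - 1) / R ^ (2 * η) := by
    rw [hR, ← Real.rpow_natCast, ← Real.rpow_mul hld.le, ← Real.rpow_mul hld.le,
      ← Real.rpow_sub hld, Nat.cast_sub hn]
    congr 1; push_cast; ring
  have h2 : 0 < R ^ (2 * η) := by rw [hR]; positivity
  rw [Box.IsBad, h1, mul_div_assoc', div_le_iff₀ h2, mul_comm (Q.count b : ℝ)]

theorem exists_badSectorProj_eq {n : ℕ} (hn : 1 ≤ n) (b : Module.Basis (Fin n) ℝ (Euc n))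
    {η K c lam δ R : ℝ} (hlam : 1 ≤ lam) (hδ : 0 < δ) (hR : R = (lam * δ) ^ (1 / 2 : ℝ))
    {ι : Type} [Fintype ι] {Ω : ι → Box n} {χ : ι → Euc n → ℝ}
    (hΩ : IsCapPartition K lam δ Ω χ) (Γ : Set (Euc n)) (f : Euc n → ℂ) :
    ∃ (S : Finset (Euc n)) (a : Euc n → ℂ), (S : Set (Euc n)) ⊆ dualLattice b ∧
      (∀ k, k ∈ S ↔ (2 * Real.pi) • k ∈ badFrequencies b c R (R ^ (2 * η)) lam δ Ω Γ) ∧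
      S.card = (badFrequencies b c R (R ^ (2 * η)) lam δ Ω Γ).ncard ∧
      badSectorProj b c η lam δ Ω χ Γ f = trigPoly b S a ∧
      ENNReal.ofReal √(∑ k ∈ S, ‖a k‖ ^ 2) ≤
        eLpNorm (sectorProj b lam δ Γ f) 2 (torusMeasure b) := by
  classical
  have hbad := isBad_iff (c := c) (η := η) hn b (by positivity : 0 < lam * δ) hR
  refine exists_torusMultiplier_eq b hlam hδ Γ (fun ξ hξ => ⟨hξ.1, hξ.2.1⟩) ?_ ?_ f
  · rintro ξ ⟨-, hξ, -⟩
    rw [Set.indicator_of_mem hξ, abs_of_nonneg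
      (Finset.sum_nonneg fun i _ => by split_ifs <;> simp [hΩ.nonneg])]
    rw [← hΩ.sum_eq_one ξ hξ.1]
    refine Finset.sum_le_sum fun i _ => ?_
    split_ifs
    · exact le_rfl
    · exact hΩ.nonneg i ξ
  · intro ξ hξ hξZ
    by_cases hs : ξ ∈ sector lam δ Γ
    · rw [Set.indicator_of_mem hs]
      refine Finset.sum_eq_zero fun i _ => ?_
      split_ifs with hi
      · by_contra hne
        exact hξZ ⟨hξ, hs, i, (hbad _).1 hi, hΩ.support i (subset_tsupport _ hne)⟩
      · rfl
    · exact Set.indicator_of_notMem hs _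

theorem proposition4p5 (n : ℕ) (hn : 2 ≤ n) :
    ∃ η₀ > (0 : ℝ), ∃ σ₂ > (0 : ℝ),
      ∀ (b : Module.Basis (Fin n) ℝ (Euc n)) (η κ τ K c s : ℝ),
        0 < η → η ≤ η₀ → η < τ → 0 < κ → 1 ≤ K → 0 < c → 0 < s →
        ∃ C > (0 : ℝ), ∀ (lam δ : ℝ), 1 ≤ lam → lam ^ (-1 + κ) ≤ δ → δ ≤ 1 →
          ∀ (ι : Type) [Fintype ι] (Ω : ι → Box n) (χ : ι → Euc n → ℝ),
            IsCapPartition K lam δ Ω χ →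
            (δ ≤ lam ^ (-τ) ∨ ∀ i, (Ω i).IsBad b c η lam δ → (Ω i).latticeDim b = n - 1) →
          ∀ Γ Γ' : Set (Euc n), Γ ⊆ polarDirections n → Γ' ⊆ polarDirections n →
            (∀ u ∈ Γ, ∀ u' ∈ Γ', s * δ ≤ ‖u - u'‖) →
          ∀ f : Euc n → ℂ, MemLp f 2 (torusMeasure b) →
            eLpNorm (fun x => ‖badSectorProj b c η lam δ Ω χ Γ f x *
                badSectorProj b c η lam δ Ω χ Γ' f x‖ ^ (1 / 2 : ℝ))
              (ENNReal.ofReal (critExp n)) (torusMeasure b) ≤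
            ENNReal.ofReal (C * (lam * δ) ^ (1 / critExp n - σ₂)) *
              (eLpNorm (sectorProj b lam δ Γ f) 2 (torusMeasure b) *
                eLpNorm (sectorProj b lam δ Γ' f) 2 (torusMeasure b)) ^ (1 / 2 : ℝ) := by
  have hn2 : (2 : ℝ) ≤ n := by exact_mod_cast hn
  -- the powers of `q = R^{2η}` lost in the counts amount to at most `R^{6(n²+2)η} ≤ R^{1/2}`
  refine ⟨1 / (12 * ((n : ℝ) * n + 2)), by positivity, 1 / (8 * ((n : ℝ) + 1)), by positivity, ?_⟩
  intro b η κ τ K c s hη hη₀ hητ hκ hK hc hs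
  obtain ⟨C, hC, hcount⟩ := exists_ncard_mul_ncard_le n hn b hη hη₀ hητ hκ hK hc hs
  have hσ := expScale_pos b
  set θ : ℝ := 1 / (2 * ((n : ℝ) + 1)) with hθ
  refine ⟨(expScale b ^ 4 * C) ^ θ, by positivity, ?_⟩
  intro lam δ hlam hδκ hδ1 ι _ Ω χ hΩ hdim Γ Γ' hΓ hΓ' hsep f _
  have hlam0 : 0 < lam := by linarith
  have hδ : 0 < δ := (Real.rpow_pos_of_pos hlam0 _).trans_le hδκ
  have hld : 0 < lam * δ := by positivity
  obtain ⟨R, hR⟩ : ∃ R, R = (lam * δ) ^ (1 / 2 : ℝ) := ⟨_, rfl⟩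
  have hR0 : 0 < R := hR ▸ by positivity
  obtain ⟨X, Y, hYX, hY, hY', hX⟩ := hcount lam δ R hlam hδκ hδ1 hR ι Ω hΩ.isCap hΩ.overlap
    (hdim.imp id fun h i hi => h i ((isBad_iff (by omega) b hld hR _).2 hi)) Γ Γ' hΓ hΓ' hsep
  obtain ⟨S, a, hSdual, hS, hScard, hSeq, hSnorm⟩ :=
    exists_badSectorProj_eq (c := c) (η := η) (by omega) b hlam hδ hR hΩ Γ f
  obtain ⟨S', a', hSdual', hS', hScard', hSeq', hSnorm'⟩ :=
    exists_badSectorProj_eq (c := c) (η := η) (by omega) b hlam hδ hR hΩ Γ' f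
  have hZfin : (badFrequencies b c R (R ^ (2 * η)) lam δ Ω Γ).Finite :=
    (finite_frequencies_sector b hlam hδ Γ).subset fun ξ hξ => ⟨hξ.1, hξ.2.1⟩
  have hX' : ∀ m, (((S ×ˢ S').filter fun p => p.1 + p.2 = m).card : ℝ) ≤ X := fun m =>
    le_trans (by exact_mod_cast card_filter_add_eq_le hZfin hS hS' m) (hX ((2 * Real.pi) • m))
  have hX0 : 0 ≤ X := (Nat.cast_nonneg _).trans (hX' 0)
  have hY0 : 0 ≤ Y := (Nat.cast_nonneg _).trans hY
  have hn1 : 0 < (n : ℝ) - 1 := by linarith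
  have hp : 0 < critExp n := by rw [critExp]; positivity
  have hp2 : critExp n / 2 = 1 + 2 * (1 / ((n : ℝ) - 1)) := by
    rw [critExp]; field_simp; ring
  have hβθ : 1 / ((n : ℝ) - 1) * (1 / critExp n) = θ := by
    rw [critExp, hθ]; field_simp
  have hint := lintegral_enorm_mul_rpow_le b hSdual hSdual' a a' (X := X) (Y := Y)
    (β := 1 / ((n : ℝ) - 1)) (by positivity) (by rw [div_le_one hn1]; linarith)
    (by rw [hScard]; exact hY) (by rw [hScard']; exact hY') hX'
  rw [hSeq, hSeq', eLpNorm_norm_rpow_half _ hp]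
  set A : ℝ := √(∑ k ∈ S, ‖a k‖ ^ 2) * √(∑ k ∈ S', ‖a' k‖ ^ 2) with hA
  have hA0 : 0 ≤ A := by positivity
  have hAle : ENNReal.ofReal A ≤ eLpNorm (sectorProj b lam δ Γ f) 2 (torusMeasure b) *
      eLpNorm (sectorProj b lam δ Γ' f) 2 (torusMeasure b) := by
    rw [hA, ENNReal.ofReal_mul (Real.sqrt_nonneg _)]
    exact mul_le_mul' hSnorm hSnorm'
  rw [← hp2] at hint
  clear_value A
  have hconst : (expScale b ^ 4 * (Y * X)) ^ θ ≤
      (expScale b ^ 4 * C) ^ θ * (lam * δ) ^ (1 / critExp n - 1 / (8 * ((n : ℝ) + 1))) := by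
    calc (expScale b ^ 4 * (Y * X)) ^ θ
        ≤ (expScale b ^ 4 * C * R ^ (2 * (n : ℝ) - 5 / 2)) ^ θ := by
          refine Real.rpow_le_rpow (by positivity) ?_ (by positivity)
          rw [mul_assoc]; gcongr
      _ = _ := by
          rw [Real.mul_rpow (by positivity) (by positivity), hR, ← Real.rpow_mul hld.le,
            ← Real.rpow_mul hld.le]
          congr 2
          rw [critExp, hθ]; field_simp; ring
  calc (∫⁻ x, ‖trigPoly b S a x * trigPoly b S' a' x‖ₑ ^ (critExp n / 2) ∂(torusMeasure b)) ^
        (1 / critExp n)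
      ≤ (ENNReal.ofReal ((expScale b ^ 4 * (Y * X)) ^ (1 / ((n : ℝ) - 1)) *
          A ^ (critExp n / 2))) ^ (1 / critExp n) := by gcongr
    _ = ENNReal.ofReal ((expScale b ^ 4 * (Y * X)) ^ θ * A ^ (1 / 2 : ℝ)) := by
        rw [ENNReal.ofReal_rpow_of_nonneg (by positivity) (by positivity),
          Real.mul_rpow (by positivity) (by positivity), ← Real.rpow_mul (by positivity), hβθ,
          ← Real.rpow_mul hA0]
        congr 3; field_simp
    _ ≤ ENNReal.ofReal ((expScale b ^ 4 * C) ^ θ *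
          (lam * δ) ^ (1 / critExp n - 1 / (8 * ((n : ℝ) + 1))) * A ^ (1 / 2 : ℝ)) := by
        gcongr
    _ = ENNReal.ofReal ((expScale b ^ 4 * C) ^ θ *
          (lam * δ) ^ (1 / critExp n - 1 / (8 * ((n : ℝ) + 1)))) *
          ENNReal.ofReal A ^ (1 / 2 : ℝ) := by
        rw [ENNReal.ofReal_mul (by positivity),
          ENNReal.ofReal_rpow_of_nonneg hA0 (by norm_num)]
    _ ≤ _ := by gcongr
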